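/- **Setting.** Let $V$ be a finite-dimensional real vector space, $I$ a finite set, $(\alpha_i)_{i\in I}$ a linearly independent family in $V^*$ and $(\alpha_i^\vee)_{i\in I}$ a linearly independent family in $V$ such that $(\alpha_i(\alpha_j^\vee))_{i,j\in I}$ is a generalized Cartan matrix. Let $r_i(v)=v-\alpha_i(v)\alpha_i^\vee$, let $W^v\subset GL(V)$ be the group generated by the $r_i$, with length $\ell$, and let $Y$ be a discrete subgroup of $V$ with all $\alpha_i^\vee\in Y$ and $\alpha_i(Y)\subset\mathbb Z$ for all $i$. Put $Q_+^\vee=\sum_i\mathbb Z_{\ge0}\alpha_i^\vee$. **Coefficient rings.** Let $\sigma_i,\sigma'_i$ ($i\in I$) be indeterminates subject only to $\sigma_i=\sigma_i'$ if $\alpha_i(Y)=\mathbb Z$, and $\sigma_i=\sigma_j=\sigma'_i=\sigma'_j$ if $\alpha_i(\alpha_j^\vee)=\alpha_j(\alpha_i^\vee)=-1$; let $E=\{i\mid\sigma_i\ne\sigma'_i\}$. Put $\mathbb Z_\sigma=\mathbb Z[\sigma_i^{\pm1},\sigma_i'^{\pm1}]_{i\in I}$ and $\mathbb Z'_\sigma=\mathbb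 Z[\sigma_i\sigma'_i,\sigma_i\sigma_i'^{-1}]_{i\in I}$. Let $\hat{\mathbb Z}_\sigma=\mathbb Z[(\sigma_i'^{\pm1})_{i\in E}](((\sigma_i)_{i\in I}))$ be the ring of Laurent series (exponents bounded below) in the $\sigma_i$ with coefficients Laurent polynomials in the $\sigma'_i$, $i\in E$, and let $\hat{\mathbb Z}'_\sigma=\mathbb Z[[(\sigma_i\sigma'_i)_{i\in I},(\sigma_i\sigma_i'^{-1})_{i\in E}]]\subset\hat{\mathbb Z}_\sigma$. A family $(t_j)$ in $\hat{\mathbb Z}_\sigma$ has sum $z$ if, for each $M$, all sufficiently large finite partial sums agree with $z$ in total degree less than $M$ in the $\sigma_i$. For a subring $R$ of $\hat{\mathbb Z}_\sigma$, let $R[[Y,-Q_+^\vee]]$ be the set of formal sums $\sum_{y\in Y}a_ye^y$, $a_y\in R$, whose support is contained in a finite union of sets $\mu-Q_+^\vee$, $\mu\in Y$. **Operators.** Let $b(t,u;z)=\dfrac{(t-t^{-1})+(u-u^{-1})z}{1-z^2}$, and let $H_i$ be the Demazure–Lusztig operator on the group algebra $\mathbb Z_\sigma[Y]$ given by $$H_i(f)=\sigma_i\,{}^{r_i}\!f+b(\sigma_i,\sigma_i';e^{\alpha_i^\vee})\,(f-{}^{r_i}\!f).$$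 For $w\in W^v$ with reduced decomposition $w=r_{i_1}\cdots r_{i_n}$, let $H_w=H_{i_1}\cdots H_{i_n}$ and $\sigma_w=\sigma_{i_1}\cdots\sigma_{i_n}$ (these do not depend on the decomposition). **Statement.** Let $\lambda\in Y$ be dominant, i.e. $\alpha_i(\lambda)\ge0$ for all $i\in I$. Let $W^v_\lambda$ be the stabilizer of $\lambda$ in $W^v$ and $(W^v)^\lambda=\{w\in W^v\mid \ell(wv)\ge\ell(w)\ \ \forall v\in W^v_\lambda\}$. Then: 1. The series $$P_\sigma^\lambda(e^\lambda)=\sum_{w\in(W^v)^\lambda}\sigma_wH_w(e^\lambda)$$ is well defined (for each $y\in Y$, only finitely many terms have a nonzero coefficient at $e^y$) and lies in $\mathbb Z_\sigma[[Y,-Q_+^\vee]]$ and in $\mathbb Z'_\sigma[[Y,-Q_+^\vee]]$. The Poincaré series $W^v_\lambda(\sigma^2)=\sum_{w\in W^v_\lambda}\sigma_w^2$ converges to a (unique) element of $\hat{\mathbb Z}'_\sigma$. 2. The series $$P_\sigma(e^\lambda)=\sum_{w\in W^v}\sigma_wH_w(e^\lambda)$$ is well defined: for each $y\in Y$, the coefficients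 at $e^y$ of its terms form a family that has a (unique) sum in $\hat{\mathbb Z}_\sigma$. It is an element of $\hat{\mathbb Z}_\sigma[[Y,-Q_+^\vee]]$ and of $\hat{\mathbb Z}'_\sigma[[Y,-Q_+^\vee]]$. 3. One has $$P_\sigma(e^\lambda)=W^v_\lambda(\sigma^2)\cdot P_\sigma^\lambda(e^\lambda).$$ -/

import Mathlib

/-- Vectorial data of Kac-Moody type together with a discrete translation lattice `Y`:
simple roots `root i` in the dual of `V` and simple coroots `coroot i` in `V`, both families free,
such that `root i (coroot j)` are the entries of a generalized Cartan matrix; `Y` is a discrete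
subgroup of `V` with `Q∨ ⊆ Y ⊆ P∨`.  (As every real root is an integral combination of simple roots,
`P∨` is the set of vectors at which all simple roots are integral.) -/
structure KMApartment (V I : Type*) [AddCommGroup V] [Module ℝ V] [TopologicalSpace V] where
  root : I → Module.Dual ℝ V
  coroot : I → V
  root_linearIndependent : LinearIndependent ℝ root
  coroot_linearIndependent : LinearIndependent ℝ coroot
  root_coroot_self : ∀ i, root i (coroot i) = 2
  root_coroot_of_ne : ∀ i j, i ≠ j → ∃ n : ℕ, root i (coroot j) = -(n : ℝ)
  root_coroot_zero : ∀ i j, root i (coroot j) = 0 → root j (coroot i) = 0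
  Y : AddSubgroup V
  coroot_mem : ∀ i, coroot i ∈ Y
  root_int : ∀ i, ∀ y ∈ Y, ∃ n : ℤ, root i y = n
  discrete : DiscreteTopology Y

namespace KMApartment

noncomputable section

variable {V I : Type*} [AddCommGroup V] [Module ℝ V] [TopologicalSpace V] (D : KMApartment V I)

/-! ### The Weyl group -/

/-- The simple reflection `r_i(v) = v - α_i(v) α_i∨`. -/
def refl (i : I) : V ≃ₗ[ℝ] V := Module.reflection (D.root_coroot_self i)

/-- The vectorial Weyl group, generated by the simple reflections. -/
def W : Subgroup (V ≃ₗ[ℝ] V) := Subgroup.closure (Set.range D.refl)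

/-- The product `r_{i_1} ⋯ r_{i_n}` attached to a word. -/
def wordProd (l : List I) : V ≃ₗ[ℝ] V := (l.map D.refl).prod

theorem exists_word (w : D.W) : ∃ l : List I, D.wordProd l = w := by
  obtain ⟨w, hw⟩ := w
  induction hw using Subgroup.closure_induction_left with
  | one => exact ⟨[], rfl⟩
  | mul_left x hx y hy ih =>
    obtain ⟨i, rfl⟩ := hx
    obtain ⟨l, hl⟩ := ih
    exact ⟨i :: l, by simpa [wordProd] using congrArg (D.refl i * ·) hl⟩
  | inv_mul_cancel x hx y hy ih =>
    obtain ⟨i, rfl⟩ := hx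
    obtain ⟨l, hl⟩ := ih
    refine ⟨i :: l, ?_⟩
    have h : (D.refl i)⁻¹ = D.refl i := by
      rw [inv_eq_iff_mul_eq_one]
      ext v
      exact Module.involutive_reflection (D.root_coroot_self i) v
    have h2 : D.wordProd (i :: l) = D.refl i * y := by
      simpa [wordProd] using congrArg (D.refl i * ·) hl
    rw [h2]
    exact congrArg (· * y) h.symm

/-- The length of an element of the Weyl group with respect to the simple reflections. -/
def length (w : D.W) : ℕ := sInf {n | ∃ l : List I, l.length = n ∧ D.wordProd l = w}

theorem exists_reducedWord (w : D.W) :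
    ∃ l : List I, l.length = D.length w ∧ D.wordProd l = w := by
  obtain ⟨l, hl⟩ := D.exists_word w
  exact Nat.sInf_mem
    (s := {n | ∃ l : List I, l.length = n ∧ D.wordProd l = w}) ⟨l.length, l, rfl, hl⟩

/-- A reduced decomposition of `w`. -/
def reducedWord (w : D.W) : List I := (D.exists_reducedWord w).choose

/-- `λ` is dominant: it lies in the closed fundamental chamber. -/
def IsDominant (lam : D.Y) : Prop := ∀ i, 0 ≤ D.root i lam

/-- The stabilizer of `λ` in the Weyl group. -/
def stab (lam : D.Y) : Subgroup D.W where
  carrier := {w | (w : V ≃ₗ[ℝ] V) (lam : V) = lam}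
  one_mem' := rfl
  mul_mem' := by
    intro a b ha hb
    change (a : V ≃ₗ[ℝ] V) ((b : V ≃ₗ[ℝ] V) (lam : V)) = lam
    rw [show (b : V ≃ₗ[ℝ] V) (lam : V) = lam from hb]
    exact ha
  inv_mem' := by
    intro a ha
    change (a : V ≃ₗ[ℝ] V).symm (lam : V) = lam
    rw [LinearEquiv.symm_apply_eq]
    exact ha.symm

/-- The minimal length representatives of the cosets of the stabilizer of `λ`. -/
def minReps (lam : D.Y) : Set D.W := {w | ∀ v ∈ D.stab lam, D.length w ≤ D.length (w * v)}

/-! ### The lattice `Y` -/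

/-- A simple coroot as an element of `Y`. -/
def cor (i : I) : D.Y := ⟨D.coroot i, D.coroot_mem i⟩

/-- The integer `α_i(y)`, for `y ∈ Y`. -/
def pairing (i : I) (y : D.Y) : ℤ := (D.root_int i y y.2).choose

theorem pairing_spec (i : I) (y : D.Y) : D.root i y = D.pairing i y :=
  (D.root_int i y y.2).choose_spec

/-- The action of the simple reflection `r_i` on `Y`. -/
def reflY (i : I) (y : D.Y) : D.Y := y - D.pairing i y • D.cor i

theorem coe_reflY (i : I) (y : D.Y) : (D.reflY i y : V) = D.refl i y := by
  simp [reflY, refl, cor, Module.reflection_apply, pairing_spec, Int.cast_smul_eq_zsmul]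

/-- `Q∨₊`, the monoid generated by the simple coroots. -/
def Qpos : AddSubmonoid D.Y := AddSubmonoid.closure (Set.range D.cor)

/-! ### The indeterminates and the coefficient rings

The conditions "`σ_i = σ_j` if `α_i(α_j∨) = α_j(α_i∨) = -1`" and "`σ'_i = σ_i` if `α_i(Y) = ℤ`" leave
one indeterminate `σ` for each class in `S`, and one further indeterminate `σ'_i` for each
`i ∈ E`, that is, with `α_i(Y) ≠ ℤ`.  (If `α_i(α_j∨) = -1` then `α_i(Y) = ℤ`.) -/

/-- Classes of indices for the equivalence relation generated by
`α_i(α_j∨) = α_j(α_i∨) = -1`. -/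
def S : Type _ := Quot fun i j : I => D.root i (D.coroot j) = -1 ∧ D.root j (D.coroot i) = -1

/-- The class of an index. -/
def cls (i : I) : D.S := Quot.mk _ i

/-- The indices `i` with `α_i(Y) ≠ ℤ`, that is, with `σ_i ≠ σ'_i`. -/
def E : Type _ := {i : I // ¬ Function.Surjective (D.pairing i)}

/-- Exponents of monomials: `(a, b)` stands for `∏_{s ∈ S} σ_s ^ a_s * ∏_{i ∈ E} (σ'_i) ^ b_i`. -/
abbrev Expo : Type _ := (D.S → ℤ) × (D.E → ℤ)

/-- The ring `ℤ[(σ'_i^{±1})_{i ∈ E}]` of Laurent polynomials. -/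
def Lau : Type _ := AddMonoidAlgebra ℤ (D.E → ℤ)

instance : CommRing D.Lau := inferInstanceAs (CommRing (AddMonoidAlgebra ℤ (D.E → ℤ)))

/-- The coefficient of a Laurent polynomial at the monomial with exponent `b`. -/
def lcoeff (p : D.Lau) (b : D.E → ℤ) : ℤ := AddMonoidAlgebra.coeff p b

/-- The completed ring `ℤ[(σ'_i^{±1})_{i ∈ E}](((σ_s)_{s ∈ S}))` of Laurent series in the `σ_s`, with
Laurent polynomials in the `σ'_i` as coefficients.  For the product order, a subset of `S → ℤ`
(`S` finite) is partially well ordered if and only if it is bounded below, so that these are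
the series with exponents bounded below. -/
abbrev ZHat : Type _ := HahnSeries (D.S → ℤ) D.Lau

/-- The monomial with a given exponent. -/
def mono (x : D.Expo) : D.ZHat := HahnSeries.single x.1 (AddMonoidAlgebra.single x.2 1 : D.Lau)

open Classical in
/-- The exponent of `σ_i`. -/
def expSigma (i : I) : D.Expo := (Pi.single (D.cls i) 1, 0)

open Classical in
/-- The exponent of `σ'_i`. -/
def expSigmaP (i : I) : D.Expo :=
  if h : Function.Surjective (D.pairing i) then D.expSigma i else (0, Pi.single ⟨i, h⟩ 1)

/-- `σ_i`. -/
def sigma (i : I) : D.ZHat := D.mono (D.expSigma i)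
/-- `σ_i⁻¹`. -/
def sigmaInv (i : I) : D.ZHat := D.mono (-D.expSigma i)
/-- `σ'_i`. -/
def sigmaP (i : I) : D.ZHat := D.mono (D.expSigmaP i)
/-- `(σ'_i)⁻¹`. -/
def sigmaPInv (i : I) : D.ZHat := D.mono (-D.expSigmaP i)

/-- The ring `ℤ_σ = ℤ[σ_i^{±1}, (σ'_i)^{±1}]`, inside its completion. -/
def ZSigma : Subring D.ZHat :=
  Subring.closure (Set.range D.sigma ∪ Set.range D.sigmaInv ∪
    Set.range D.sigmaP ∪ Set.range D.sigmaPInv)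

/-- The ring `ℤ'_σ = ℤ[σ_i σ'_i, σ_i (σ'_i)⁻¹]`. -/
def ZSigmaP : Subring D.ZHat :=
  Subring.closure (Set.range (fun i => D.sigma i * D.sigmaP i) ∪
    Set.range (fun i => D.sigma i * D.sigmaPInv i))

/-- The exponents of the monomials in the `σ_i σ'_i` and the `σ_i (σ'_i)⁻¹` (which is `1` for
`i ∉ E`). -/
def expP : AddSubmonoid D.Expo :=
  AddSubmonoid.closure (Set.range (fun i => D.expSigma i + D.expSigmaP i) ∪
    Set.range (fun i => D.expSigma i - D.expSigmaP i))

/-- The completion `ℤ[[(σ_i σ'_i)_{i ∈ I}, (σ_i (σ'_i)⁻¹)_{i ∈ E}]]` of `ℤ'_σ`: the series all of whose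
monomials are products of the `σ_i σ'_i` and `σ_i (σ'_i)⁻¹`. -/
def ZHatP : Subring D.ZHat where
  carrier := {f | ∀ a b, D.lcoeff (f.coeff a) b ≠ 0 → (a, b) ∈ D.expP}
  zero_mem' := by intro a b h; exact absurd rfl h
  one_mem' := by
    intro a b h
    rw [HahnSeries.coeff_one] at h
    split_ifs at h with ha
    · subst ha
      have hb : b = 0 := by
        by_contra hb
        exact h (Finsupp.single_eq_of_ne hb)
      subst hb
      exact D.expP.zero_mem
    · exact absurd rfl h
  add_mem' := by
    intro f g hf hg a b h
    by_cases h1 : D.lcoeff (f.coeff a) b = 0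
    · refine hg a b fun h2 => h ?_
      change D.lcoeff (f.coeff a) b + D.lcoeff (g.coeff a) b = 0
      rw [h1, h2, add_zero]
    · exact hf a b h1
  neg_mem' := by
    intro f hf a b h
    refine hf a b fun h2 => h ?_
    change -D.lcoeff (f.coeff a) b = 0
    rw [h2, neg_zero]
  mul_mem' := by
    intro f g hf hg a b h
    classical
    let φ : D.Lau →+ ℤ :=
      { toFun := fun p => D.lcoeff p b, map_zero' := rfl, map_add' := fun _ _ => rfl }
    change φ ((f * g).coeff a) ≠ 0 at h
    rw [HahnSeries.coeff_mul, map_sum] at h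
    obtain ⟨⟨a1, a2⟩, ha, h⟩ := Finset.exists_ne_zero_of_sum_ne_zero h
    have hs : a1 + a2 = a := (Finset.mem_antidiagonal.1 ha).2.2
    have hb := AddMonoidAlgebra.support_coeff_mul_subset (x := f.coeff a1) (y := g.coeff a2)
      (Finsupp.mem_support_iff.2 h)
    obtain ⟨b1, hb1, b2, hb2, hb'⟩ := Finset.mem_add.1 hb
    have := D.expP.add_mem (hf a1 b1 (Finsupp.mem_support_iff.1 hb1))
      (hg a2 b2 (Finsupp.mem_support_iff.1 hb2))
    rw [← hs, ← hb']
    exact this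

/-- `R[[Y, -Q∨₊]]`, for a subring `R` of the completed coefficient ring: the formal sums
`∑_{y ∈ Y} f(y) e^y` with coefficients in `R` and support in a finite union of cones `μ - Q∨₊`. -/
def formalSums (R : Subring D.ZHat) : Set (D.Y → D.ZHat) :=
  {f | (∀ y, f y ∈ R) ∧ ∃ F : Finset D.Y, ∀ y, f y ≠ 0 → ∃ μ ∈ F, μ - y ∈ D.Qpos}

/-! ### Demazure-Lusztig operators -/

/-- `e^μ` -/
def e (μ : D.Y) : AddMonoidAlgebra D.ZHat D.Y := AddMonoidAlgebra.single μ 1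

open Classical in
/-- `σ_i - σ_i⁻¹` for even `k`, and `σ'_i - (σ'_i)⁻¹` for odd `k`. -/
def bCoeff (i : I) (k : ℕ) : D.ZHat :=
  if Even k then D.sigma i - D.sigmaInv i else D.sigmaP i - D.sigmaPInv i

/-- The value at `e^μ` of the `i`-th Demazure-Lusztig operator
`H_i(f) = σ_i r_i(f) + b(σ_i, σ'_i; e^{α_i∨}) (f - r_i(f))`, where
`b(t, u; z) = ((t - t⁻¹) + (u - u⁻¹) z) / (1 - z²)`; here the division is carried out,
and `heckeBasis_spec` below is the identity that characterizes the result. -/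
def heckeBasis (i : I) (μ : D.Y) : AddMonoidAlgebra D.ZHat D.Y :=
  D.sigma i • D.e (D.reflY i μ) +
    if 0 ≤ D.pairing i μ then
      -∑ k ∈ Finset.range (D.pairing i μ).toNat, D.bCoeff i (k + 1) • D.e (μ - (k + 1) • D.cor i)
    else
      ∑ k ∈ Finset.range (-D.pairing i μ).toNat, D.bCoeff i k • D.e (μ + k • D.cor i)

/-- The Demazure-Lusztig operator `H_i`. -/
def heckeGen (i : I) :
    AddMonoidAlgebra D.ZHat D.Y →ₗ[D.ZHat] AddMonoidAlgebra D.ZHat D.Y :=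
  Finsupp.linearCombination D.ZHat (D.heckeBasis i) ∘ₗ
    (AddMonoidAlgebra.coeffLinearEquiv D.ZHat).toLinearMap

theorem heckeGen_e (i : I) (μ : D.Y) : D.heckeGen i (D.e μ) = D.heckeBasis i μ := by
  simp [heckeGen, e]

theorem e_mul (μ ν : D.Y) : D.e μ * D.e ν = D.e (μ + ν) := by
  simp [e, AddMonoidAlgebra.single_mul_single]

theorem bCoeff_add_two (i : I) (k : ℕ) : D.bCoeff i (k + 2) = D.bCoeff i k := by
  simp [bCoeff, Nat.even_add]

theorem bCoeff_of_even (i : I) {n k : ℕ} (h : Even n) : D.bCoeff i (n + k) = D.bCoeff i k := by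
  simp [bCoeff, Nat.even_add, h]

theorem bCoeff_of_surjective (i : I) (h : Function.Surjective (D.pairing i)) (n k : ℕ) :
    D.bCoeff i n = D.bCoeff i k := by
  simp [bCoeff, sigma, sigmaP, sigmaInv, sigmaPInv, expSigmaP, h]

theorem surjective_of_odd (i : I) (μ : D.Y) (h : Odd (D.pairing i μ)) :
    Function.Surjective (D.pairing i) := by
  obtain ⟨m, hm⟩ := h
  intro n
  refine ⟨n • (μ - m • D.cor i), ?_⟩
  have h1 := D.pairing_spec i μ
  have h2 : D.root i (D.cor i : V) = 2 := D.root_coroot_self i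
  have h3 := D.pairing_spec i (n • (μ - m • D.cor i))
  rw [hm] at h1
  push_cast at h1
  simp only [AddSubgroup.coe_zsmul, AddSubgroup.coe_sub, map_zsmul, map_sub, h1, h2] at h3
  have h4 : (n : ℝ) = D.pairing i (n • (μ - m • D.cor i)) := by
    rw [← h3]; simp only [zsmul_eq_mul]; ring
  exact_mod_cast h4.symm

theorem bCoeff_add_natAbs (i : I) (μ : D.Y) (n k : ℕ) (hn : n = (D.pairing i μ).natAbs) :
    D.bCoeff i (n + k) = D.bCoeff i k := by
  rcases Nat.even_or_odd n with h | h
  · exact D.bCoeff_of_even i h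
  · refine D.bCoeff_of_surjective i (D.surjective_of_odd i μ ?_) _ _
    rwa [hn, Int.natAbs_odd] at h

/-- `(1 - z²) H_i(e^μ) = σ_i (1 - z²) e^{r_i μ} + ((σ_i - σ_i⁻¹) + (σ'_i - (σ'_i)⁻¹) z) (e^μ - e^{r_i μ})`
with `z = e^{α_i∨}`. -/
theorem heckeBasis_spec (i : I) (μ : D.Y) :
    (1 - D.e (D.cor i) * D.e (D.cor i)) * D.heckeBasis i μ =
      D.sigma i • ((1 - D.e (D.cor i) * D.e (D.cor i)) * D.e (D.reflY i μ)) +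
        ((D.sigma i - D.sigmaInv i) • (1 : AddMonoidAlgebra D.ZHat D.Y) +
          (D.sigmaP i - D.sigmaPInv i) • D.e (D.cor i)) * (D.e μ - D.e (D.reflY i μ)) := by
  have hb0 : D.sigma i - D.sigmaInv i = D.bCoeff i 0 := by simp [bCoeff]
  have hb1 : D.sigmaP i - D.sigmaPInv i = D.bCoeff i 1 := by simp [bCoeff]
  rw [hb0, hb1, heckeBasis, mul_add, mul_smul_comm, add_right_inj, e_mul]
  simp only [add_mul, smul_mul_assoc, one_mul, mul_sub, sub_mul, e_mul]
  split_ifs with h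
  · obtain ⟨n, hn⟩ := Int.eq_ofNat_of_zero_le h
    have key : ∀ n : ℕ, (∑ k ∈ Finset.range n, D.bCoeff i (k + 1) • D.e (μ - (k + 1) • D.cor i)) -
        D.e (D.cor i + D.cor i) *
          ∑ k ∈ Finset.range n, D.bCoeff i (k + 1) • D.e (μ - (k + 1) • D.cor i) =
        D.bCoeff i n • D.e (μ - n • D.cor i) + D.bCoeff i (n + 1) • D.e (D.cor i + (μ - n • D.cor i))
          - D.bCoeff i 0 • D.e μ - D.bCoeff i 1 • D.e (D.cor i + μ) := by
      intro n
      induction n with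
      | zero => simp
      | succ n ih =>
        rw [Finset.sum_range_succ, mul_add, mul_smul_comm, e_mul, bCoeff_add_two]
        have e1 : D.cor i + D.cor i + (μ - (n + 1) • D.cor i) = D.cor i + (μ - n • D.cor i) := by
          rw [succ_nsmul]; abel
        have e2 : D.cor i + (μ - (n + 1) • D.cor i) = μ - n • D.cor i := by
          rw [succ_nsmul]; abel
        rw [e1, e2, add_sub_add_comm, ih]
        abel
    have hr : D.reflY i μ = μ - n • D.cor i := by simp [reflY, hn]
    rw [hn, hr, Int.toNat_natCast]
    have hneg : ∀ x y : AddMonoidAlgebra D.ZHat D.Y, -x - y * -x = -(x - y * x) := by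
      intro x y; ring
    have := key n
    rw [D.bCoeff_add_natAbs i μ n 1 (by simp [hn]),
      show D.bCoeff i n = D.bCoeff i 0 from D.bCoeff_add_natAbs i μ n 0 (by simp [hn])] at this
    rw [hneg, this]
    abel
  · obtain ⟨n, hn⟩ : ∃ n : ℕ, -D.pairing i μ = n := Int.eq_ofNat_of_zero_le (by omega)
    have key : ∀ n : ℕ, (∑ k ∈ Finset.range n, D.bCoeff i k • D.e (μ + k • D.cor i)) -
        D.e (D.cor i + D.cor i) * ∑ k ∈ Finset.range n, D.bCoeff i k • D.e (μ + k • D.cor i) =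
        D.bCoeff i 0 • D.e μ + D.bCoeff i 1 • D.e (D.cor i + μ) -
        (D.bCoeff i n • D.e (μ + n • D.cor i) +
          D.bCoeff i (n + 1) • D.e (D.cor i + (μ + n • D.cor i))) := by
      intro n
      induction n with
      | zero => simp
      | succ n ih =>
        rw [Finset.sum_range_succ, mul_add, mul_smul_comm, e_mul, bCoeff_add_two]
        have e1 : D.cor i + D.cor i + (μ + n • D.cor i) = D.cor i + (μ + (n + 1) • D.cor i) := by
          rw [succ_nsmul]; abel
        have e2 : D.cor i + (μ + n • D.cor i) = μ + (n + 1) • D.cor i := by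
          rw [succ_nsmul]; abel
        rw [e1, add_sub_add_comm, ih, e2]
        abel
    have hr : D.reflY i μ = μ + n • D.cor i := by
      rw [reflY, show D.pairing i μ = -(n : ℤ) by omega]; simp
    rw [hn, hr, Int.toNat_natCast]
    have := key n
    rw [D.bCoeff_add_natAbs i μ n 1 (by omega),
      show D.bCoeff i n = D.bCoeff i 0 from D.bCoeff_add_natAbs i μ n 0 (by omega)] at this
    rw [this]

/-- `σ_w = σ_{i_1} ⋯ σ_{i_n}` for a reduced decomposition `w = r_{i_1} ⋯ r_{i_n}`
(independent of the decomposition). -/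
def sigmaW (w : D.W) : D.ZHat := ((D.reducedWord w).map D.sigma).prod

/-- `H_w = H_{i_1} ⋯ H_{i_n}`, as an operator, for a reduced decomposition
`w = r_{i_1} ⋯ r_{i_n}` (independent of the decomposition). -/
def hecke (w : D.W) : Module.End D.ZHat (AddMonoidAlgebra D.ZHat D.Y) :=
  ((D.reducedWord w).map D.heckeGen).prod

/-- The coefficient of `e^y` in `σ_w H_w(e^λ)`. -/
def term (lam : D.Y) (w : D.W) (y : D.Y) : D.ZHat :=
  D.sigmaW w * (D.hecke w (D.e lam)).coeff y

/-! ### Convergence -/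

/-- The family `t` of Laurent series is summable with sum `z`, for the topology given by the total
degree in the `σ_s`: for each `M`, all sufficiently large finite partial sums agree with `z` in
total degree less than `M`. -/
def IsSum {ι : Type*} (t : ι → D.ZHat) (z : D.ZHat) : Prop :=
  ∀ M : ℤ, ∃ F₀ : Finset ι, ∀ F : Finset ι, F₀ ⊆ F →
    ∀ a : D.S → ℤ, ∑ᶠ s, a s < M → (∑ j ∈ F, t j).coeff a = z.coeff a

/-- `f` is the series `P_σ(e^λ) = ∑_{w} σ_w H_w(e^λ)`, the sum over the whole Weyl group
being taken coefficient by coefficient in the completed ring.  All large finite partial sums are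
considered, in particular the sums over `{w | ℓ(w) ≤ N}` as `N → ∞`. -/
def IsPSigma (lam : D.Y) (f : D.Y → D.ZHat) : Prop :=
  ∀ y, D.IsSum (fun w : D.W => D.term lam w y) (f y)

/-- `f` is the series `P_σ^λ(e^λ) = ∑_{w} σ_w H_w(e^λ)`, over the minimal length coset
representatives `w`; each coefficient is a sum with finitely many nonzero terms. -/
def IsPSigmaMin (lam : D.Y) (f : D.Y → D.ZHat) : Prop :=
  ∀ y, {w ∈ D.minReps lam | D.term lam w y ≠ 0}.Finite ∧
    f y = ∑ᶠ w ∈ D.minReps lam, D.term lam w y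

/-- `z` is the Poincaré series `W'(σ²) = ∑_{w ∈ W'} σ_w²`. -/
def IsPoincare (W' : Subgroup D.W) (z : D.ZHat) : Prop :=
  D.IsSum (fun w : W' => D.sigmaW w ^ 2) z

end

end KMApartment

/-!
The Weyl group is the product of `(W^v)^λ` and `W^v_λ`, with `ℓ(u v) = ℓ(u) + ℓ(v)`
(`exists_minRep`, `IsDominant.minRep_unique`, `IsDominant.length_mul`). Hence `σ_{uv} = σ_u σ_v` and
`H_{uv} = H_u H_v`. If `r_i` fixes `λ` then `H_i(e^λ) = σ_i e^λ`, so `H_v(e^λ) = σ_v e^λ` for `v` in the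
stabilizer, and `σ_{uv} H_{uv}(e^λ) = σ_v² σ_u H_u(e^λ)` (`IsDominant.term_mul`). Summing over `v`
first gives the product formula. Three points need an argument.

*Independence of the reduced words.* `prod_eq_of_reduced` (Matsumoto-Tits) reduces it to the braid
relations of `H_i` and `H_j`. These are checked in the total ring of fractions of the group
algebra, where `H_i = σ_i + a_i (1 - r_i)` with `a_i = b(σ_i, σ'_i; e^{α_i∨}) - σ_i`. The operators
`X_i = a_i (1 - r_i)` satisfy `X_i² = -(σ_i + σ_i⁻¹) X_i`, so the braid relation becomes a statement
on alternating products of the `X_i` (`braid_three`, `braid_four`, `braid_six`). Corrected by shorter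
ones, the longest alternating product is the antisymmetrizer of the dihedral group, multiplied by
the product of the `a` of all the positive roots, and so is symmetric in `i` and `j`
(`dd_braid_three`, `dd_four`, `dd_six`). The functional equations used there follow from
`1 / ((1 - x) (1 - y)) = (1 / (1 - x) + 1 / (1 - y) - 1) / (1 - x y)`.

*Finiteness for `P_σ^λ`.* The operator `H_i` moves an exponent along the segment to its image
under `r_i`. Following exponents along a reduced word as a folded gallery, `IsDominant.support_bound`
shows that the exponents `y` of `H_w(e^λ)`, for `w` a minimal coset representative, satisfy
`λ - y ∈ Q∨₊` and `ℓ(w) ≤ 2 ht(λ - y)`. As there are finitely many elements of a given length, each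
coefficient is a finite sum. The estimates rest on the positivity of roots and coroots
(`IsRootRep.inv_apply_mem`), on strong exchange (`length_mul_reflection_lt`), and on the bound
`ℓ(r_β) < 2 ht(β∨)` (`length_reflection_le`).

*Convergence and coefficients.* `σ_v²` is a monomial of degree `2 ℓ(v)` in the `σ_s`, which gives
the Poincaré series (`exists_isSum`). The elements of `ℤ̂'_σ` only have nonnegative exponents, so
that multiplication by them is compatible with sums (`IsSum.mul`). Finally, `σ_i H_i` is defined
over `ℤ'_σ`, as `σ_i² = (σ_i σ'_i) (σ_i σ'_i⁻¹)` (`term_mem`).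
-/

namespace KMApartment

noncomputable section

variable {V I : Type*} [AddCommGroup V] [Module ℝ V] [TopologicalSpace V] (D : KMApartment V I)

/-! ### Words in the simple reflections -/

/-- The simple reflection `r_i` as an element of the Weyl group. -/
def s (i : I) : D.W := ⟨D.refl i, Subgroup.subset_closure ⟨i, rfl⟩⟩

/-- The element of the Weyl group represented by a word. -/
def wp (l : List I) : D.W := (l.map D.s).prod

@[simp] theorem wp_nil : D.wp [] = 1 := rfl

@[simp] theorem wp_cons (i : I) (l : List I) : D.wp (i :: l) = D.s i * D.wp l := by simp [wp]

@[simp] theorem wp_append (l l' : List I) : D.wp (l ++ l') = D.wp l * D.wp l' := by simp [wp]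

theorem coe_wp (l : List I) : (D.wp l : V ≃ₗ[ℝ] V) = D.wordProd l := by
  induction l with
  | nil => rfl
  | cons i l ih => simp [wordProd] at ih ⊢; rw [ih]; rfl

theorem refl_apply (i : I) (v : V) : D.refl i v = v - D.root i v • D.coroot i := by
  simp [refl, Module.reflection_apply]

@[simp] theorem s_mul_s (i : I) : D.s i * D.s i = 1 := by
  apply Subtype.ext
  ext v
  exact Module.involutive_reflection (D.root_coroot_self i) v

@[simp] theorem s_inv (i : I) : (D.s i)⁻¹ = D.s i := by
  rw [inv_eq_iff_mul_eq_one, s_mul_s]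

@[simp] theorem s_mul_cancel (i : I) (w : D.W) : D.s i * (D.s i * w) = w := by
  rw [← mul_assoc, s_mul_s, one_mul]

theorem wp_reverse (l : List I) : D.wp l.reverse = (D.wp l)⁻¹ := by
  induction l with
  | nil => simp
  | cons i l ih => simp [ih]

theorem length_wp_le (l : List I) : D.length (D.wp l) ≤ l.length :=
  Nat.sInf_le ⟨l, rfl, (D.coe_wp l).symm⟩

theorem exists_reduced (w : D.W) : ∃ l : List I, l.length = D.length w ∧ D.wp l = w := by
  obtain ⟨l, h, h'⟩ := D.exists_reducedWord w
  exact ⟨l, h, Subtype.ext ((D.coe_wp l).trans h')⟩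

theorem length_reducedWord (w : D.W) : (D.reducedWord w).length = D.length w :=
  (D.exists_reducedWord w).choose_spec.1

theorem wp_reducedWord (w : D.W) : D.wp (D.reducedWord w) = w :=
  Subtype.ext ((D.coe_wp _).trans (D.exists_reducedWord w).choose_spec.2)

@[simp] theorem length_one : D.length 1 = 0 := Nat.le_zero.1 (D.length_wp_le [])

theorem length_mul_le (x y : D.W) : D.length (x * y) ≤ D.length x + D.length y := by
  obtain ⟨l, h, rfl⟩ := D.exists_reduced x
  obtain ⟨l', h', rfl⟩ := D.exists_reduced y
  rw [← h, ← h', ← wp_append, ← List.length_append]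
  exact D.length_wp_le _

theorem length_inv_le (x : D.W) : D.length x⁻¹ ≤ D.length x := by
  obtain ⟨l, h, rfl⟩ := D.exists_reduced x
  rw [← h, ← wp_reverse, ← List.length_reverse (as := l)]
  exact D.length_wp_le _

@[simp] theorem length_inv (x : D.W) : D.length x⁻¹ = D.length x :=
  le_antisymm (D.length_inv_le x) (by simpa using D.length_inv_le x⁻¹)

theorem length_s_le (i : I) : D.length (D.s i) ≤ 1 := by
  simpa using D.length_wp_le [i]

theorem length_s_mul_le (i : I) (w : D.W) : D.length (D.s i * w) ≤ D.length w + 1 := by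
  have := D.length_mul_le (D.s i) w
  have := D.length_s_le i
  omega

theorem length_le_s_mul (i : I) (w : D.W) : D.length w ≤ D.length (D.s i * w) + 1 := by
  simpa using D.length_s_mul_le i (D.s i * w)

theorem eq_one_of_length {w : D.W} (h : D.length w = 0) : w = 1 := by
  obtain ⟨l, hl, rfl⟩ := D.exists_reduced w
  rw [h, List.length_eq_zero_iff] at hl
  simp [hl]

/-- A nontrivial element has a left descent. -/
theorem exists_descent {w : D.W} (h : w ≠ 1) : ∃ i, D.length (D.s i * w) + 1 = D.length w := by
  obtain ⟨l, hl, rfl⟩ := D.exists_reduced w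
  cases l with
  | nil => simp at h
  | cons i l =>
    refine ⟨i, ?_⟩
    have h1 := D.length_wp_le l
    have h2 := D.length_le_s_mul i (D.wp (i :: l))
    simp at hl h2 ⊢
    omega

/-! ### The Cartan matrix -/

/-- The generalized Cartan matrix, with integral entries `α_i(α_j∨)`. -/
def A (i j : I) : ℤ := D.pairing i (D.cor j)

theorem root_coroot (i j : I) : D.root i (D.coroot j) = D.A i j := D.pairing_spec i (D.cor j)

@[simp] theorem A_self (i : I) : D.A i i = 2 := by
  have := D.root_coroot i i
  rw [D.root_coroot_self] at this
  exact_mod_cast this.symm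

theorem exists_A_eq {i j : I} (h : i ≠ j) : ∃ n : ℕ, D.A i j = -n := by
  obtain ⟨n, hn⟩ := D.root_coroot_of_ne i j h
  exact ⟨n, by rw [root_coroot] at hn; exact_mod_cast hn⟩

theorem A_zero {i j : I} (h : D.A i j = 0) : D.A j i = 0 := by
  have := D.root_coroot_zero i j (by rw [root_coroot, h]; simp)
  rw [root_coroot] at this
  exact_mod_cast this

theorem A_zero_iff {i j : I} : D.A i j = 0 ↔ D.A j i = 0 := ⟨D.A_zero, D.A_zero⟩

/-- The order of `r_i r_j` in terms of the product of the Cartan integers; `0` stands for infinite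
order. -/
def coxOf : ℕ → ℕ
  | 0 => 2
  | 1 => 3
  | 2 => 4
  | 3 => 6
  | _ => 0

/-- The order of `r_i r_j`, for `i ≠ j`; `0` stands for infinite order. -/
def cox (i j : I) : ℕ := coxOf (D.A i j * D.A j i).toNat

theorem cox_comm (i j : I) : D.cox i j = D.cox j i := by rw [cox, cox, mul_comm]

/-- The alternating word `i, j, i, …` with `n` letters. -/
def alt : I → I → ℕ → List I
  | _, _, 0 => []
  | i, j, n + 1 => i :: alt j i n

@[simp] theorem length_alt (i j : I) (n : ℕ) : (alt i j n).length = n := by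
  induction n generalizing i j with
  | zero => rfl
  | succ n ih => simp [alt, ih]

theorem exists_alt_add (i j : I) (m n : ℕ) : ∃ l : List I, l.length = n ∧
    alt i j (m + n) = alt i j m ++ l := by
  induction m generalizing i j with
  | zero => exact ⟨alt i j n, by simp, by simp [alt]⟩
  | succ m ih =>
    obtain ⟨l, h, h'⟩ := ih j i
    exact ⟨l, h, by rw [show m + 1 + n = (m + n) + 1 by omega]; simp [alt, h']⟩

/-- The possible orders of `r_i r_j`, with the pairs of Cartan integers for which they are finite. -/
theorem cartan_cases {i j : I} (h : i ≠ j) :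
    (D.cox i j = 2 ∧ D.A i j = 0 ∧ D.A j i = 0) ∨
    (D.cox i j = 3 ∧ D.A i j = -1 ∧ D.A j i = -1) ∨
    (D.cox i j = 4 ∧ (D.A i j = -1 ∧ D.A j i = -2 ∨ D.A i j = -2 ∧ D.A j i = -1)) ∨
    (D.cox i j = 6 ∧ (D.A i j = -1 ∧ D.A j i = -3 ∨ D.A i j = -3 ∧ D.A j i = -1)) ∨
    (D.cox i j = 0 ∧ 4 ≤ D.A i j * D.A j i) := by
  obtain ⟨c, hc⟩ := D.exists_A_eq h
  obtain ⟨d, hd⟩ := D.exists_A_eq h.symm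
  have h0 := D.A_zero_iff (i := i) (j := j)
  have hm : D.A i j * D.A j i = (c * d : ℕ) := by rw [hc, hd]; push_cast; ring
  have hcox : D.cox i j = coxOf (c * d) := by rw [cox, hm]; rfl
  rw [hcox, hm, hc, hd]
  rw [hc, hd] at h0
  simp only [neg_eq_zero, Nat.cast_eq_zero] at h0
  by_cases h4 : 4 ≤ c * d
  · right; right; right; right
    obtain ⟨k, hk⟩ := Nat.exists_eq_add_of_le h4
    refine ⟨by rw [hk, add_comm]; rfl, by exact_mod_cast h4⟩
  · by_cases hc0 : c = 0
    · have := h0.1 hc0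
      subst hc0; subst this
      simp [coxOf]
    · have hd0 : d ≠ 0 := fun h => hc0 (h0.2 h)
      have h1 : c ≤ 3 := by nlinarith [Nat.pos_of_ne_zero hd0]
      have h2 : d ≤ 3 := by nlinarith [Nat.pos_of_ne_zero hc0]
      interval_cases c <;> interval_cases d <;> simp_all [coxOf]

/-! ### Dihedral subgroups -/

/-- The coefficients obtained from `p a + q b` by applying `n` reflections alternately, the first
one being `b ↦ -b`, `a ↦ a + c b`, and the second one `a ↦ -a`, `b ↦ b + d a`. -/
def dihedralCoeff : ℤ → ℤ → ℕ → ℤ → ℤ → ℤ × ℤ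
  | _, _, 0, p, q => (p, q)
  | c, d, n + 1, p, q => (dihedralCoeff d c n (c * p - q) p).swap

/-- In the infinite dihedral case, `2 q ≤ c p` is preserved by the two reflections, and it keeps the
coefficients nonnegative. -/
theorem dihedralCoeff_nonneg_of_le {c d : ℤ} (hc : 0 ≤ c) (hd : 0 ≤ d) (h : 4 ≤ c * d) (n : ℕ)
    {p q : ℤ} (hp : 0 ≤ p) (hq : 0 ≤ q) (hpq : 2 * q ≤ c * p) :
    0 ≤ (dihedralCoeff c d n p q).1 ∧ 0 ≤ (dihedralCoeff c d n p q).2 := by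
  induction n generalizing c d p q with
  | zero => exact ⟨hp, hq⟩
  | succ n ih =>
    have := ih hd hc (by linarith [mul_comm c d]) (p := c * p - q) (q := p) (by linarith) hp
      (by nlinarith [mul_le_mul_of_nonneg_left hpq hd, mul_le_mul_of_nonneg_right h hp])
    exact this.symm

/-- Fewer alternating reflections than the order of `r_i r_j` do not make a simple root negative. -/
theorem dihedralCoeff_nonneg {i j : I} (h : i ≠ j) {n : ℕ} (hn : D.cox i j = 0 ∨ n < D.cox i j) :
    0 ≤ (dihedralCoeff (-D.A i j) (-D.A j i) n 1 0).1 ∧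
      0 ≤ (dihedralCoeff (-D.A i j) (-D.A j i) n 1 0).2 := by
  rcases D.cartan_cases h with h | h | h | h | h
  · obtain ⟨h1, h2, h3⟩ := h
    simp only [h1, h2, h3] at hn ⊢
    have : n < 2 := by omega
    interval_cases n <;> decide
  · obtain ⟨h1, h2, h3⟩ := h
    simp only [h1, h2, h3] at hn ⊢
    have : n < 3 := by omega
    interval_cases n <;> decide
  · obtain ⟨h1, ⟨h2, h3⟩ | ⟨h2, h3⟩⟩ := h <;>
    · simp only [h1, h2, h3] at hn ⊢
      have : n < 4 := by omega
      interval_cases n <;> decide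
  · obtain ⟨h1, ⟨h2, h3⟩ | ⟨h2, h3⟩⟩ := h <;>
    · simp only [h1, h2, h3] at hn ⊢
      have : n < 6 := by omega
      interval_cases n <;> decide
  · obtain ⟨c, hc⟩ := D.exists_A_eq ‹i ≠ j›
    obtain ⟨d, hd⟩ := D.exists_A_eq (Ne.symm ‹i ≠ j›)
    refine dihedralCoeff_nonneg_of_le ?_ ?_ ?_ n zero_le_one le_rfl ?_
    · simp [hc]
    · simp [hd]
    · linarith [h.2]
    · simp [hc]

/-- The braid relations in the Weyl group. -/
theorem wp_braid {i j : I} (h : i ≠ j) :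
    D.wp (alt i j (D.cox i j)) = D.wp (alt j i (D.cox i j)) := by
  have key : ∀ l l' : List I, (∀ v, D.wordProd l v = D.wordProd l' v) → D.wp l = D.wp l' := by
    intro l l' hl
    apply Subtype.ext
    rw [coe_wp, coe_wp]
    exact LinearEquiv.ext hl
  have e1 := D.root_coroot i j
  have e2 := D.root_coroot j i
  have e3 := D.root_coroot_self i
  have e4 := D.root_coroot_self j
  rcases D.cartan_cases h with h | h | h | h | h
  · obtain ⟨h1, h2, h3⟩ := h
    rw [h2] at e1; rw [h3] at e2; rw [h1]
    refine key _ _ fun v => ?_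
    simp [wordProd, alt, refl_apply, e1, e2]
    module
  · obtain ⟨h1, h2, h3⟩ := h
    rw [h2] at e1; rw [h3] at e2; rw [h1]
    refine key _ _ fun v => ?_
    simp [wordProd, alt, refl_apply, e1, e2, e3, e4]
    module
  · obtain ⟨h1, ⟨h2, h3⟩ | ⟨h2, h3⟩⟩ := h <;>
    · rw [h2] at e1; rw [h3] at e2; rw [h1]
      refine key _ _ fun v => ?_
      simp [wordProd, alt, refl_apply, e1, e2, e3, e4]
      module
  · obtain ⟨h1, ⟨h2, h3⟩ | ⟨h2, h3⟩⟩ := h <;>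
    · rw [h2] at e1; rw [h3] at e2; rw [h1]
      refine key _ _ fun v => ?_
      simp [wordProd, alt, refl_apply, e1, e2, e3, e4]
      module
  · rw [h.1]; rfl

/-- Every element is the product of an alternating word and of an element without left descent
among the two letters, with additivity of lengths. -/
theorem exists_alt_mul (v : D.W) (i j : I) (h : D.length v ≤ D.length (D.s j * v)) :
    ∃ n v', v = D.wp (alt i j n) * v' ∧ D.length v = n + D.length v' ∧
      D.length v' ≤ D.length (D.s i * v') ∧ D.length v' ≤ D.length (D.s j * v') := by
  induction hn : D.length v generalizing v i j with
  | zero => exact ⟨0, v, by simp [alt], by simp [hn], by simp [hn], by simp [hn]⟩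
  | succ k ih =>
    by_cases h' : D.length v ≤ D.length (D.s i * v)
    · exact ⟨0, v, by simp [alt], by simp [hn], h', h⟩
    · have h1 := D.length_le_s_mul i v
      obtain ⟨n, v', e1, e2, e3, e4⟩ := ih (D.s i * v) j i (by simp; omega) (by omega)
      refine ⟨n + 1, v', ?_, by omega, e4, e3⟩
      rw [alt, wp_cons, mul_assoc, ← e1, s_mul_cancel]

/-! ### Positivity of roots and coroots -/

/-- An action of the Weyl group on a group `M` containing simple vectors `a_i`, given on these by
the formula for simple roots or by the formula for simple coroots. -/
structure IsRootRep {M : Type*} [AddCommGroup M] (ρ : D.W →* AddMonoid.End M) (a : I → M) :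
    Prop where
  apply : (∀ i j, ρ (D.s i) (a j) = a j - D.A i j • a i) ∨
    (∀ i j, ρ (D.s i) (a j) = a j - D.A j i • a i)

section RootRep

variable {D} {M : Type*} [AddCommGroup M] {ρ : D.W →* AddMonoid.End M} {a : I → M}

theorem IsRootRep.self (h : D.IsRootRep ρ a) (i : I) : ρ (D.s i) (a i) = -a i := by
  have : a i - (2 : ℤ) • a i = -a i := by rw [two_smul]; abel
  rcases h.apply with h | h <;> rw [h, A_self, this]

/-- The inverse of an alternating word acts on the plane spanned by two simple vectors through the
coefficients `dihedralCoeff`. -/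
theorem IsRootRep.alt_apply {i j : I} {c d : ℤ} (hi : ρ (D.s i) (a i) = -a i)
    (hj : ρ (D.s j) (a j) = -a j) (hij : ρ (D.s i) (a j) = a j + c • a i)
    (hji : ρ (D.s j) (a i) = a i + d • a j) (n : ℕ) (p q : ℤ) :
    ρ (D.wp (alt i j n))⁻¹ (p • a j + q • a i) =
      (dihedralCoeff c d n p q).1 • a j + (dihedralCoeff c d n p q).2 • a i := by
  induction n generalizing i j c d p q with
  | zero => simp [alt, dihedralCoeff]
  | succ n ih =>
    have h1 : ρ (D.s i) (p • a j + q • a i) = (c * p - q) • a i + p • a j := by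
      rw [map_add, map_zsmul, map_zsmul, hi, hij]; module
    rw [alt, wp_cons, mul_inv_rev, s_inv, map_mul, AddMonoid.End.coe_mul,
      Function.comp_apply, h1, ih hj hi hji hij]
    simp only [dihedralCoeff, Prod.fst_swap, Prod.snd_swap]
    abel

/-- Alternating words shorter than the order of `r_i r_j` send `a_j` to a nonnegative combination of
`a_i` and `a_j`. -/
theorem IsRootRep.alt_apply_mem (h : D.IsRootRep ρ a) {i j : I} (hij : i ≠ j) {n : ℕ}
    (hn : D.cox i j = 0 ∨ n < D.cox i j) :
    ∃ p q : ℕ, ρ (D.wp (alt i j n))⁻¹ (a j) = p • a j + q • a i := by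
  obtain ⟨c, d, h1, h2, h3⟩ : ∃ c d : ℤ, ρ (D.s i) (a j) = a j + c • a i ∧
      ρ (D.s j) (a i) = a i + d • a j ∧
      0 ≤ (dihedralCoeff c d n 1 0).1 ∧ 0 ≤ (dihedralCoeff c d n 1 0).2 := by
    rcases h.apply with h | h
    · exact ⟨_, _, by rw [h, neg_smul, sub_eq_add_neg], by rw [h, neg_smul, sub_eq_add_neg],
        D.dihedralCoeff_nonneg hij hn⟩
    · exact ⟨_, _, by rw [h, neg_smul, sub_eq_add_neg], by rw [h, neg_smul, sub_eq_add_neg],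
        D.dihedralCoeff_nonneg hij.symm (by rwa [cox_comm])⟩
  have h4 := IsRootRep.alt_apply (h.self i) (h.self j) h1 h2 n 1 0
  obtain ⟨p, hp⟩ := Int.eq_ofNat_of_zero_le h3.1
  obtain ⟨q, hq⟩ := Int.eq_ofNat_of_zero_le h3.2
  rw [hp, hq] at h4
  exact ⟨p, q, by simpa using h4⟩

/-- If `r_i` is not a left descent of `w`, then `w⁻¹ a_i` is a positive root: for a left descent
`r_j` of `w`, split off the maximal alternating word in `r_j` and `r_i` on the left of `w`. Its
inverse sends `a_i` to a nonnegative combination of `a_i` and `a_j`, and neither reflection is a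
left descent of the remaining factor. -/
theorem IsRootRep.inv_apply_mem (h : D.IsRootRep ρ a) {w : D.W} {i : I}
    (hw : D.length w ≤ D.length (D.s i * w)) :
    ρ w⁻¹ (a i) ∈ AddSubmonoid.closure (Set.range a) := by
  induction hn : D.length w using Nat.strong_induction_on generalizing w i with
  | _ n ih =>
    have ha : ∀ i, a i ∈ AddSubmonoid.closure (Set.range a) := fun i =>
      AddSubmonoid.subset_closure ⟨i, rfl⟩
    by_cases h1 : w = 1
    · subst h1; simpa using ha i
    obtain ⟨j, hj⟩ := D.exists_descent h1
    have hji : j ≠ i := by rintro rfl; omega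
    obtain ⟨L, v, e1, e2, e3, e4⟩ := D.exists_alt_mul w j i hw
    have hL : L ≠ 0 := by
      rintro rfl
      simp only [alt, wp_nil, one_mul] at e1
      subst e1
      omega
    have hL' : D.cox j i = 0 ∨ L < D.cox j i := by
      by_contra hcon
      push Not at hcon
      obtain ⟨k, hk⟩ := Nat.exists_eq_add_of_le hcon.2
      obtain ⟨l, hl, hl'⟩ := exists_alt_add j i (D.cox j i) k
      -- otherwise the braid relation makes `r_i` a left descent of `w`
      rw [hk, hl', wp_append, D.wp_braid hji] at e1
      obtain ⟨m, hm⟩ := Nat.exists_eq_succ_of_ne_zero hcon.1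
      rw [hm, alt, wp_cons] at e1
      have : D.s i * w = D.wp (alt j i m ++ l) * v := by rw [e1]; simp [mul_assoc]
      have h5 := D.length_mul_le (D.wp (alt j i m ++ l)) v
      have h6 := D.length_wp_le (alt j i m ++ l)
      simp only [List.length_append, length_alt] at h6
      rw [this] at hw
      omega
    obtain ⟨p, q, hpq⟩ := h.alt_apply_mem hji hL'
    rw [e1, mul_inv_rev, map_mul, AddMonoid.End.coe_mul, Function.comp_apply, hpq, map_add,
      map_nsmul, map_nsmul]
    exact add_mem (nsmul_mem (ih _ (by omega) e4 rfl) _) (nsmul_mem (ih _ (by omega) e3 rfl) _)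

theorem IsRootRep.inv_apply_neg_mem (h : D.IsRootRep ρ a) {w : D.W} {i : I}
    (hw : D.length (D.s i * w) ≤ D.length w) :
    -ρ w⁻¹ (a i) ∈ AddSubmonoid.closure (Set.range a) := by
  have := h.inv_apply_mem (w := D.s i * w) (i := i) (by simpa using hw)
  rwa [mul_inv_rev, s_inv, map_mul, AddMonoid.End.coe_mul, Function.comp_apply, h.self,
    map_neg] at this

/-- If `r_i` is not a right descent of `w`, then `w a_i` is a positive root. -/
theorem IsRootRep.apply_mem (h : D.IsRootRep ρ a) {w : D.W} {i : I}
    (hw : D.length w ≤ D.length (w * D.s i)) :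
    ρ w (a i) ∈ AddSubmonoid.closure (Set.range a) := by
  have := h.inv_apply_mem (w := w⁻¹) (i := i) (by
    rw [← D.length_inv (D.s i * w⁻¹)]; simpa using hw)
  rwa [inv_inv] at this

theorem IsRootRep.apply_neg_mem (h : D.IsRootRep ρ a) {w : D.W} {i : I}
    (hw : D.length (w * D.s i) ≤ D.length w) :
    -ρ w (a i) ∈ AddSubmonoid.closure (Set.range a) := by
  have := h.inv_apply_neg_mem (w := w⁻¹) (i := i) (by
    rw [← D.length_inv (D.s i * w⁻¹)]; simpa using hw)
  rwa [inv_inv] at this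

end RootRep

/-- The action of the Weyl group on the vector space. -/
def actV : D.W →* AddMonoid.End V where
  toFun w := (w : V ≃ₗ[ℝ] V).toLinearMap.toAddMonoidHom
  map_one' := rfl
  map_mul' _ _ := rfl

@[simp] theorem actV_apply (w : D.W) (v : V) : D.actV w v = (w : V ≃ₗ[ℝ] V) v := rfl

/-- The contragredient action of the Weyl group on the dual space. -/
def actDual : D.W →* AddMonoid.End (Module.Dual ℝ V) where
  toFun w := ((w⁻¹ : D.W) : V ≃ₗ[ℝ] V).toLinearMap.dualMap.toAddMonoidHom
  map_one' := rfl
  map_mul' x y := by rw [mul_inv_rev]; rfl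

@[simp] theorem actDual_apply (w : D.W) (f : Module.Dual ℝ V) (v : V) :
    D.actDual w f v = f (((w⁻¹ : D.W) : V ≃ₗ[ℝ] V) v) := rfl

theorem actDual_apply_act (w : D.W) (f : Module.Dual ℝ V) (v : V) :
    D.actDual w f ((w : V ≃ₗ[ℝ] V) v) = f v :=
  congrArg f ((w : V ≃ₗ[ℝ] V).symm_apply_apply v)

theorem coe_s_apply (i : I) (v : V) :
    ((D.s i : D.W) : V ≃ₗ[ℝ] V) v = v - D.root i v • D.coroot i := D.refl_apply i v

theorem isRootRep_coroot : D.IsRootRep D.actV D.coroot where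
  apply := Or.inl fun i j => by
    rw [actV_apply, coe_s_apply, root_coroot, Int.cast_smul_eq_zsmul]

theorem isRootRep_root : D.IsRootRep D.actDual D.root where
  apply := Or.inr fun i j => by
    ext v
    rw [actDual_apply, s_inv, coe_s_apply, map_sub, map_smul, root_coroot,
      ← Int.cast_smul_eq_zsmul ℝ]
    simp [mul_comm]

/-- A linearly independent family admits a linear map giving coordinates on its span. -/
theorem exists_coord {M : Type*} [AddCommGroup M] [Module ℝ M] {a : I → M}
    (h : LinearIndependent ℝ a) : ∃ c : M →ₗ[ℝ] (I →₀ ℝ), ∀ i, c (a i) = Finsupp.single i 1 := by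
  obtain ⟨g, hg⟩ := LinearMap.exists_leftInverse_of_injective (Finsupp.linearCombination ℝ a)
    (LinearMap.ker_eq_bot.2 h)
  exact ⟨g, fun i => by simpa using LinearMap.congr_fun hg (Finsupp.single i 1)⟩

section Coord

variable {M : Type*} [AddCommGroup M] [Module ℝ M] {a : I → M} {c : M →ₗ[ℝ] (I →₀ ℝ)}

theorem coord_nonneg (hc : ∀ i, c (a i) = Finsupp.single i 1) {x : M}
    (hx : x ∈ AddSubmonoid.closure (Set.range a)) (k : I) : 0 ≤ c x k := by
  classical
  induction hx using AddSubmonoid.closure_induction with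
  | mem x hx =>
    obtain ⟨i, rfl⟩ := hx
    rw [hc, Finsupp.single_apply]
    split_ifs <;> simp
  | zero => simp
  | add x y _ _ hx hy => simpa using add_nonneg hx hy

theorem eq_sum_coord (hc : ∀ i, c (a i) = Finsupp.single i 1) {x : M}
    (hx : x ∈ AddSubmonoid.closure (Set.range a)) :
    Finsupp.linearCombination ℝ a (c x) = x := by
  induction hx using AddSubmonoid.closure_induction with
  | mem x hx => obtain ⟨i, rfl⟩ := hx; simp [hc]
  | zero => simp
  | add x y _ _ hx hy => simp [hx, hy]

theorem eq_zero_of_mem_of_neg_mem (h : LinearIndependent ℝ a) {x : M}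
    (hx : x ∈ AddSubmonoid.closure (Set.range a))
    (hx' : -x ∈ AddSubmonoid.closure (Set.range a)) : x = 0 := by
  obtain ⟨c, hc⟩ := exists_coord h
  have : c x = 0 := by
    ext k
    have h1 := coord_nonneg hc hx k
    have h2 := coord_nonneg hc hx' k
    simp at h1 h2 ⊢
    linarith
  rw [← eq_sum_coord hc hx, this, map_zero]

/-- A positive combination `x` of the `a_i` such that `r x = x - t a_j` is negative is a multiple
of `a_j`. -/
theorem eq_smul_of_mem_of_neg_mem (h : LinearIndependent ℝ a) {x : M} {j : I} {t : ℝ}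
    (hx : x ∈ AddSubmonoid.closure (Set.range a))
    (hx' : -(x - t • a j) ∈ AddSubmonoid.closure (Set.range a)) : ∃ u : ℝ, x = u • a j := by
  classical
  obtain ⟨c, hc⟩ := exists_coord h
  have : c x = Finsupp.single j (c x j) := by
    ext k
    by_cases hk : k = j
    · simp [hk]
    have h1 := coord_nonneg hc hx k
    have h2 := coord_nonneg hc hx' k
    simp only [map_neg, map_sub, map_smul, hc, Finsupp.neg_apply, Finsupp.sub_apply,
      Finsupp.smul_apply, Finsupp.single_apply, if_neg (Ne.symm hk), smul_zero, sub_zero] at h1 h2 ⊢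
    linarith
  exact ⟨c x j, by conv_lhs => rw [← eq_sum_coord hc hx, this]
                   simp⟩

end Coord

/-- `w α_i` is a positive root. -/
def PosRoot (w : D.W) (i : I) : Prop :=
  D.actDual w (D.root i) ∈ AddSubmonoid.closure (Set.range D.root)

theorem root_ne_zero (w : D.W) (i : I) : D.actDual w (D.root i) ≠ 0 := by
  intro h
  have := D.actDual_apply_act w (D.root i) (D.coroot i)
  rw [h, root_coroot_self] at this
  simp at this

theorem coroot_ne_zero (w : D.W) (i : I) : (w : V ≃ₗ[ℝ] V) (D.coroot i) ≠ 0 := by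
  intro h
  have := D.actDual_apply_act w (D.root i) (D.coroot i)
  rw [h, root_coroot_self] at this
  simp at this

theorem posRoot_iff (w : D.W) (i : I) : D.PosRoot w i ↔ D.length w ≤ D.length (w * D.s i) := by
  refine ⟨fun h => ?_, fun h => D.isRootRep_root.apply_mem h⟩
  by_contra h'
  exact D.root_ne_zero w i (eq_zero_of_mem_of_neg_mem D.root_linearIndependent h
    (D.isRootRep_root.apply_neg_mem (not_le.1 h').le))

theorem posRoot_iff_lt (w : D.W) (i : I) : D.PosRoot w i ↔ D.length w < D.length (w * D.s i) := by
  refine ⟨fun h => ?_, fun h => (D.posRoot_iff w i).2 h.le⟩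
  by_contra h'
  exact D.root_ne_zero w i (eq_zero_of_mem_of_neg_mem D.root_linearIndependent h
    (D.isRootRep_root.apply_neg_mem (not_lt.1 h')))

theorem length_mul_s {w : D.W} {i : I} (h : D.PosRoot w i) :
    D.length (w * D.s i) = D.length w + 1 := by
  have h1 := (D.posRoot_iff_lt w i).1 h
  have h2 := D.length_mul_le w (D.s i)
  have h3 := D.length_s_le i
  omega

theorem PosRoot.coroot_mem {D : KMApartment V I} {w : D.W} {i : I} (h : D.PosRoot w i) :
    (w : V ≃ₗ[ℝ] V) (D.coroot i) ∈ AddSubmonoid.closure (Set.range D.coroot) :=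
  D.isRootRep_coroot.apply_mem ((D.posRoot_iff w i).1 h)

theorem neg_root_mem_of_not_posRoot {w : D.W} {i : I} (h : ¬ D.PosRoot w i) :
    -D.actDual w (D.root i) ∈ AddSubmonoid.closure (Set.range D.root) := by
  rw [posRoot_iff, not_le] at h
  exact D.isRootRep_root.apply_neg_mem h.le

theorem neg_coroot_mem_of_not_posRoot {w : D.W} {i : I} (h : ¬ D.PosRoot w i) :
    -(w : V ≃ₗ[ℝ] V) (D.coroot i) ∈ AddSubmonoid.closure (Set.range D.coroot) := by
  rw [posRoot_iff, not_le] at h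
  exact D.isRootRep_coroot.apply_neg_mem h.le

/-- The reflection `w r_i w⁻¹` associated with the root `w α_i`. -/
def reflection (w : D.W) (i : I) : D.W := w * D.s i * w⁻¹

theorem reflection_apply (w : D.W) (i : I) (v : V) :
    (D.reflection w i : V ≃ₗ[ℝ] V) v =
      v - D.actDual w (D.root i) v • (w : V ≃ₗ[ℝ] V) (D.coroot i) := by
  have h : (w : V ≃ₗ[ℝ] V) (((w⁻¹ : D.W) : V ≃ₗ[ℝ] V) v) = v :=
    (w : V ≃ₗ[ℝ] V).apply_symm_apply v
  change (w : V ≃ₗ[ℝ] V) (((D.s i : D.W) : V ≃ₗ[ℝ] V) (((w⁻¹ : D.W) : V ≃ₗ[ℝ] V) v)) = _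
  rw [coe_s_apply, map_sub, map_smul, h, actDual_apply]

/-- The simple root `α_j` is the only positive root made negative by `r_j`. -/
theorem reflection_eq_s {w : D.W} {i j : I} (h : D.PosRoot w i) (h' : ¬ D.PosRoot (D.s j * w) i) :
    D.reflection w i = D.s j := by
  have h1 := D.neg_root_mem_of_not_posRoot h'
  have h2 := D.neg_coroot_mem_of_not_posRoot h'
  have e1 : D.actDual (D.s j * w) (D.root i) =
      D.actDual w (D.root i) - (D.actDual w (D.root i) (D.coroot j)) • D.root j := by
    ext v
    rw [map_mul, AddMonoid.End.coe_mul, Function.comp_apply, actDual_apply, s_inv, coe_s_apply]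
    simp [mul_comm]
  have e2 : ((D.s j * w : D.W) : V ≃ₗ[ℝ] V) (D.coroot i) =
      (w : V ≃ₗ[ℝ] V) (D.coroot i) - D.root j ((w : V ≃ₗ[ℝ] V) (D.coroot i)) • D.coroot j :=
    D.coe_s_apply j _
  rw [e1] at h1
  rw [e2] at h2
  obtain ⟨t, ht⟩ := eq_smul_of_mem_of_neg_mem D.root_linearIndependent h h1
  obtain ⟨u, hu⟩ := eq_smul_of_mem_of_neg_mem D.coroot_linearIndependent h.coroot_mem h2
  have htu : t * u = 1 := by
    have := D.actDual_apply_act w (D.root i) (D.coroot i)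
    rw [ht, hu, root_coroot_self] at this
    simp [root_coroot_self] at this
    linarith
  apply Subtype.ext
  ext v
  rw [reflection_apply, coe_s_apply, ht, hu]
  simp only [LinearMap.smul_apply, smul_smul, smul_eq_mul]
  congr 2
  linear_combination D.root j v * htu

/-- The strong exchange property: if `x` makes the positive root `p α_i` negative, then multiplication
by the reflection in this root shortens `x`, since it deletes a letter of any reduced word. -/
theorem length_mul_reflection_lt {x p : D.W} {i : I} (hp : D.PosRoot p i)
    (hx : ¬ D.PosRoot (x * p) i) : D.length (x * D.reflection p i) < D.length x := by
  obtain ⟨l, hl, rfl⟩ := D.exists_reduced x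
  rw [← hl]
  suffices ∃ l' : List I, l'.length < l.length ∧ D.wp l' = D.wp l * D.reflection p i by
    obtain ⟨l', h1, h2⟩ := this
    rw [← h2]
    exact (D.length_wp_le l').trans_lt h1
  clear hl
  induction l with
  | nil => simp at hx; exact absurd hp hx
  | cons j l ih =>
    by_cases h : D.PosRoot (D.wp l * p) i
    · have := D.reflection_eq_s h (j := j) (by rwa [wp_cons, mul_assoc] at hx)
      refine ⟨l, by simp, ?_⟩
      have e : D.wp l * D.reflection p i = D.reflection (D.wp l * p) i * D.wp l := by
        simp [reflection, mul_assoc]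
      rw [wp_cons, mul_assoc, e, this, s_mul_cancel]
    · obtain ⟨l', h1, h2⟩ := ih h
      exact ⟨j :: l', by simpa using h1, by simp [h2, mul_assoc]⟩

/-! ### Reduced words and braid relations -/

/-- The Matsumoto-Tits theorem: if a family in a monoid satisfies the braid relations, then its
product along a reduced word depends only on the element represented by the word. -/
theorem prod_eq_of_reduced {N : Type*} [Monoid N] (f : I → N)
    (hf : ∀ i j, i ≠ j → ((alt i j (D.cox i j)).map f).prod = ((alt j i (D.cox i j)).map f).prod)
    (l l' : List I) (h : D.wp l = D.wp l') (hl : l.length = D.length (D.wp l))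
    (hl' : l'.length = D.length (D.wp l')) : (l.map f).prod = (l'.map f).prod := by
  induction hn : l.length generalizing l l' with
  | zero =>
    have : l'.length = 0 := by rw [hl', ← h, ← hl, hn]
    rw [List.length_eq_zero_iff] at hn this
    rw [hn, this]
  | succ n ih =>
    match l, l', hn with
    | i :: l, [], _ => simp [← h] at hl' hl; omega
    | i :: l, j :: l', hn =>
      have tail : ∀ (k : I) (m : List I), (k :: m).length = D.length (D.wp (k :: m)) →
          m.length = D.length (D.wp m) := by
        intro k m hm
        have h1 := D.length_wp_le m
        have h2 := D.length_s_mul_le k (D.wp m)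
        simp at hm
        omega
      have hlt := tail i l hl
      have hlt' := tail j l' hl'
      simp only [List.length_cons] at hl hl' hn
      have hn' : l'.length = n := by rw [← h] at hl'; omega
      by_cases hij : i = j
      · subst hij
        have := ih l l' (by simpa using h) hlt hlt' (by omega)
        simp [this]
      obtain ⟨L, v, e1, e2, e3, e4⟩ := D.exists_alt_mul (D.wp l) j i (by
        have : D.s i * D.wp l = D.wp (i :: l) := by simp
        rw [this]; omega)
      have hw : D.wp (i :: l) = D.wp (alt i j (L + 1)) * v := by
        rw [wp_cons, e1, alt, wp_cons, mul_assoc]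
      -- as `r_i` and `r_j` are left descents, the alternating part has at least `cox i j` letters
      have hL : D.cox i j ≠ 0 ∧ D.cox i j ≤ L + 1 := by
        by_contra hcon
        have hcon' : D.cox i j = 0 ∨ L + 1 < D.cox i j := by omega
        obtain ⟨p, q, hpq⟩ := D.isRootRep_root.alt_apply_mem hij hcon'
        have h1 : D.actDual (D.wp (i :: l))⁻¹ (D.root j) ∈
            AddSubmonoid.closure (Set.range D.root) := by
          rw [hw, mul_inv_rev, map_mul, AddMonoid.End.coe_mul, Function.comp_apply, hpq,
            map_add, map_nsmul, map_nsmul]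
          exact add_mem (nsmul_mem (D.isRootRep_root.inv_apply_mem e3) _)
            (nsmul_mem (D.isRootRep_root.inv_apply_mem e4) _)
        have h2 := D.isRootRep_root.inv_apply_neg_mem (w := D.wp (i :: l)) (i := j) (by
          rw [h, wp_cons, s_mul_cancel, ← wp_cons]; omega)
        exact D.root_ne_zero _ _ (eq_zero_of_mem_of_neg_mem D.root_linearIndependent h1 h2)
      obtain ⟨k, hk⟩ := Nat.exists_eq_add_of_le hL.2
      obtain ⟨r, hr, hr'⟩ := exists_alt_add i j (D.cox i j) k
      obtain ⟨t, ht, rfl⟩ := D.exists_reduced v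
      obtain ⟨m, hm⟩ := Nat.exists_eq_succ_of_ne_zero hL.1
      rw [hk, hr'] at hw
      have b := D.wp_braid hij
      have bf := hf i j hij
      rw [hm] at hw b bf hk
      simp only [alt, wp_cons, wp_append, List.cons_append, List.map_cons, List.prod_cons] at hw b bf
      have hlen : ∀ i j : I, (alt i j m ++ (r ++ t)).length = n := by
        intro i j
        simp only [List.length_append, length_alt]
        omega
      have hA : D.wp l = D.wp (alt j i m ++ (r ++ t)) := by
        have := mul_left_cancel (hw.trans (by simp only [mul_assoc]) :
          D.s i * D.wp l = D.s i * (D.wp (alt j i m) * (D.wp r * D.wp t)))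
        simpa using this
      have hB : D.wp l' = D.wp (alt i j m ++ (r ++ t)) := by
        have h1 : D.s j * D.wp l' = D.s j * (D.wp (alt i j m) * (D.wp r * D.wp t)) := by
          rw [← wp_cons, ← h, wp_cons, hw, ← mul_assoc (D.s i), b]
          simp only [mul_assoc]
        simpa using mul_left_cancel h1
      -- the induction applies to the tails, and the braid relation exchanges the two heads
      have hA' := ih l _ hA hlt (by rw [← hA, hlen]; omega) (by omega)
      have hB' := ih l' _ hB hlt' (by rw [← hB, hlen]; omega) (by omega)
      simp only [List.map_cons, List.prod_cons, hA', hB', List.map_append, List.prod_append]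
      rw [← mul_assoc, ← mul_assoc, ← mul_assoc, bf]
      simp only [mul_assoc]

/-! ### Heights -/

theorem exists_ht : ∃ f : V →ₗ[ℝ] ℝ, ∀ i, f (D.coroot i) = 1 := by
  obtain ⟨c, hc⟩ := exists_coord D.coroot_linearIndependent
  exact ⟨Finsupp.linearCombination ℝ (fun _ => (1 : ℝ)) ∘ₗ c, fun i => by simp [hc]⟩

/-- A linear form taking the value `1` at all simple coroots. -/
def ht : V →ₗ[ℝ] ℝ := D.exists_ht.choose

@[simp] theorem ht_coroot (i : I) : D.ht (D.coroot i) = 1 := D.exists_ht.choose_spec i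

/-- The monoid `Q∨₊`, inside the vector space. -/
def cone : AddSubmonoid V := AddSubmonoid.closure (Set.range D.coroot)

theorem coroot_mem_cone (i : I) : D.coroot i ∈ D.cone := AddSubmonoid.subset_closure ⟨i, rfl⟩

variable {D} in
theorem eq_zero_or_ht {x : V} (h : x ∈ D.cone) : x = 0 ∨ 1 ≤ D.ht x := by
  induction h using AddSubmonoid.closure_induction with
  | mem x hx => obtain ⟨i, rfl⟩ := hx; simp
  | zero => simp
  | add x y _ _ hx hy =>
    rcases hx with rfl | hx <;> rcases hy with rfl | hy <;> simp_all
    right; linarith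

variable {D} in
theorem ht_nonneg {x : V} (h : x ∈ D.cone) : 0 ≤ D.ht x := by
  rcases eq_zero_or_ht h with rfl | h
  · simp
  · linarith

variable {D} in
theorem mem_Y_of_mem_cone {x : V} (h : x ∈ D.cone) : x ∈ D.Y := by
  induction h using AddSubmonoid.closure_induction with
  | mem x hx => obtain ⟨i, rfl⟩ := hx; exact D.coroot_mem i
  | zero => exact zero_mem _
  | add x y _ _ hx hy => exact add_mem hx hy

variable {D} in
theorem mem_Qpos_iff {x : D.Y} : x ∈ D.Qpos ↔ (x : V) ∈ D.cone := by
  have : D.Qpos.map D.Y.subtype = D.cone := by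
    rw [Qpos, AddMonoidHom.map_mclosure, ← Set.range_comp]; rfl
  rw [← this]
  constructor
  · exact fun h => ⟨x, h, rfl⟩
  · rintro ⟨y, hy, hxy⟩
    rwa [← Subtype.ext hxy]

theorem act_mem_Y (w : D.W) {y : V} (hy : y ∈ D.Y) : (w : V ≃ₗ[ℝ] V) y ∈ D.Y := by
  obtain ⟨l, -, rfl⟩ := D.exists_reduced w
  induction l with
  | nil => exact hy
  | cons i l ih =>
    obtain ⟨n, hn⟩ := D.root_int i _ ih
    have e : ((D.wp (i :: l) : D.W) : V ≃ₗ[ℝ] V) y = _ := D.coe_s_apply i ((D.wp l : V ≃ₗ[ℝ] V) y)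
    rw [e, hn, Int.cast_smul_eq_zsmul]
    exact sub_mem ih (zsmul_mem (D.coroot_mem i) n)

theorem s_mul_apply (i : I) (w : D.W) (v : V) : ((D.s i * w : D.W) : V ≃ₗ[ℝ] V) v =
    (w : V ≃ₗ[ℝ] V) v - D.root i ((w : V ≃ₗ[ℝ] V) v) • D.coroot i := D.coe_s_apply i _

/-- The length of the reflection in a positive root is less than twice the height of the coroot. -/
theorem length_reflection_le {w : D.W} {i : I} (h : D.PosRoot w i) :
    (D.length (D.reflection w i) : ℝ) + 1 ≤ 2 * D.ht ((w : V ≃ₗ[ℝ] V) (D.coroot i)) := by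
  obtain ⟨N, hN⟩ := exists_nat_ge (D.ht ((w : V ≃ₗ[ℝ] V) (D.coroot i)))
  have one_le : ∀ w : D.W, D.PosRoot w i → 1 ≤ D.ht ((w : V ≃ₗ[ℝ] V) (D.coroot i)) := fun w h =>
    (eq_zero_or_ht h.coroot_mem).resolve_left (D.coroot_ne_zero w i)
  induction N generalizing w with
  | zero => have := one_le w h; simp at hN; linarith
  | succ N ih =>
    set β := (w : V ≃ₗ[ℝ] V) (D.coroot i) with hβ
    -- since the root takes the value `2` at its coroot, some simple root is positive there
    obtain ⟨j, hj⟩ : ∃ j, 0 < D.root j β := by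
      by_contra! hcon
      have : ∀ f ∈ AddSubmonoid.closure (Set.range D.root), f β ≤ 0 := by
        intro f hf
        induction hf using AddSubmonoid.closure_induction with
        | mem x hx => obtain ⟨j, rfl⟩ := hx; exact hcon j
        | zero => simp
        | add x y _ _ hx hy => simpa using add_nonpos hx hy
      have h2 := this _ h
      rw [hβ, actDual_apply_act, root_coroot_self] at h2
      norm_num at h2
    by_cases h' : D.PosRoot (D.s j * w) i
    · obtain ⟨n, hn⟩ := D.root_int j β (mem_Y_of_mem_cone h.coroot_mem)
      have hn1 : (1 : ℝ) ≤ n := by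
        rw [hn] at hj
        exact_mod_cast (Int.cast_pos.1 hj : 0 < n)
      have e : D.ht (((D.s j * w : D.W) : V ≃ₗ[ℝ] V) (D.coroot i)) = D.ht β - n := by
        rw [s_mul_apply, ← hβ, hn]; simp
      have h1 := ih h' (by rw [e]; push_cast at hN; linarith)
      have e2 : D.reflection w i = D.s j * (D.reflection (D.s j * w) i * D.s j) := by
        simp [reflection, mul_assoc]
      have h2 : D.length (D.reflection w i) ≤ D.length (D.reflection (D.s j * w) i) + 2 := by
        rw [e2]
        have a1 := D.length_s_mul_le j (D.reflection (D.s j * w) i * D.s j)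
        have a2 := D.length_mul_le (D.reflection (D.s j * w) i) (D.s j)
        have a3 := D.length_s_le j
        omega
      have h3 : (D.length (D.reflection w i) : ℝ) ≤
          D.length (D.reflection (D.s j * w) i) + 2 := by exact_mod_cast h2
      rw [e] at h1
      linarith
    · rw [D.reflection_eq_s h h']
      have h1 : (D.length (D.s j) : ℝ) ≤ 1 := by exact_mod_cast D.length_s_le j
      have := one_le w h
      linarith

/-! ### The stabilizer of a dominant element -/

theorem mem_stab {lam : D.Y} {w : D.W} :
    w ∈ D.stab lam ↔ (w : V ≃ₗ[ℝ] V) (lam : V) = lam := Iff.rfl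

section Dominant

variable {D} {lam : D.Y} (hlam : D.IsDominant lam)

include hlam

/-- If `r_i` is not a left descent of `w`, then `α_i(w λ)` is a nonnegative integer. -/
theorem IsDominant.exists_root_eq {w : D.W} {i : I} (h : D.length w ≤ D.length (D.s i * w)) :
    ∃ n : ℕ, D.root i ((w : V ≃ₗ[ℝ] V) lam) = n := by
  obtain ⟨n, hn⟩ := D.root_int i _ (D.act_mem_Y w lam.2)
  have key : ∀ f ∈ AddSubmonoid.closure (Set.range D.root), 0 ≤ f lam := by
    intro f hf
    induction hf using AddSubmonoid.closure_induction with
    | mem x hx => obtain ⟨j, rfl⟩ := hx; exact hlam j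
    | zero => simp
    | add x y _ _ hx hy => simpa using add_nonneg hx hy
  have h1 := key _ (D.isRootRep_root.inv_apply_mem h)
  rw [actDual_apply, inv_inv, hn] at h1
  obtain ⟨m, rfl⟩ := Int.eq_ofNat_of_zero_le (Int.cast_nonneg_iff.1 h1)
  exact ⟨m, by simpa using hn⟩

/-- `w λ ≤ λ` for `λ` dominant. -/
theorem IsDominant.sub_mem_cone (w : D.W) : (lam : V) - (w : V ≃ₗ[ℝ] V) lam ∈ D.cone := by
  induction hn : D.length w generalizing w with
  | zero => rw [D.eq_one_of_length hn]; simp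
  | succ n ih =>
    obtain ⟨i, hi⟩ := D.exists_descent (w := w) (by rintro rfl; simp at hn)
    obtain ⟨m, hm⟩ := hlam.exists_root_eq (w := D.s i * w) (i := i) (by simp; omega)
    have h1 := ih (D.s i * w) (by omega)
    have e := D.s_mul_apply i (D.s i * w) lam
    rw [s_mul_cancel, hm, Nat.cast_smul_eq_nsmul] at e
    rw [e, sub_sub_eq_add_sub, add_sub_right_comm]
    exact add_mem h1 (nsmul_mem (D.coroot_mem_cone i) m)

/-- A left descent of an element of the stabilizer of `λ` fixes `λ`, because all the elements of the
orbit lie below `λ`. -/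
theorem IsDominant.of_mem_stab {w : D.W} {i : I} (hw : w ∈ D.stab lam)
    (hi : D.length (D.s i * w) + 1 = D.length w) :
    D.s i ∈ D.stab lam ∧ D.s i * w ∈ D.stab lam := by
  obtain ⟨m, hm⟩ := hlam.exists_root_eq (w := D.s i * w) (i := i) (by simp; omega)
  have h1 := hlam.sub_mem_cone (D.s i * w)
  have e := D.s_mul_apply i (D.s i * w) lam
  rw [s_mul_cancel, hm, (D.mem_stab).1 hw] at e
  have e' : (lam : V) - ((D.s i * w : D.W) : V ≃ₗ[ℝ] V) lam = -((m : ℝ) • D.coroot i) := by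
    nth_rewrite 1 [e]; abel
  have h2 := ht_nonneg h1
  rw [e'] at h2
  have hm0 : (m : ℝ) = 0 := by
    have : (0 : ℝ) ≤ m := Nat.cast_nonneg m
    simp at h2
    simpa using h2
  rw [hm0, zero_smul, sub_zero] at e
  refine ⟨?_, e.symm⟩
  rw [mem_stab, coe_s_apply, e, hm, hm0, zero_smul, sub_zero]

/-- The letters of a reduced word of an element of the stabilizer of `λ` fix `λ`. -/
theorem IsDominant.s_mem_stab {l : List I} (hw : D.wp l ∈ D.stab lam)
    (hl : l.length = D.length (D.wp l)) : ∀ i ∈ l, D.s i ∈ D.stab lam := by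
  induction l with
  | nil => simp
  | cons i l ih =>
    have h1 := D.length_wp_le l
    have h2 := D.length_s_mul_le i (D.wp l)
    simp only [List.length_cons, wp_cons] at hl hw
    obtain ⟨h3, h4⟩ := hlam.of_mem_stab hw (by rw [s_mul_cancel]; omega)
    rw [s_mul_cancel] at h4
    intro j hj
    rcases List.mem_cons.1 hj with rfl | hj
    · exact h3
    · exact ih h4 (by omega) j hj

/-- Lengths add up in the decomposition of the Weyl group into cosets of the stabilizer. -/
theorem IsDominant.length_mul {u v : D.W} (hu : u ∈ D.minReps lam) (hv : v ∈ D.stab lam) :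
    D.length (u * v) = D.length u + D.length v := by
  obtain ⟨l, hl, rfl⟩ := D.exists_reduced v
  have hs := hlam.s_mem_stab hv hl
  rw [← hl]
  induction l using List.reverseRecOn with
  | nil => simp
  | append_singleton l i ih =>
    have h1 := D.length_wp_le l
    have h2 := D.length_mul_le (D.wp l) (D.s i)
    have h3 := D.length_s_le i
    simp only [wp_append, wp_cons, wp_nil, mul_one, List.length_append, List.length_cons,
      List.length_nil] at hl hv ⊢
    have hi : D.s i ∈ D.stab lam := hs i (by simp)
    have hl' : D.wp l ∈ D.stab lam := by
      have := mul_mem hv hi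
      rwa [mul_assoc, s_mul_s, mul_one] at this
    have h4 := ih hl' (by omega) fun j hj => hs j (by simp [hj])
    -- otherwise, by strong exchange, a reflection of the stabilizer shortens `u`
    have hpos : D.PosRoot (u * D.wp l) i := by
      by_contra hneg
      have h5 := D.length_mul_reflection_lt ((D.posRoot_iff (D.wp l) i).2 (by omega)) hneg
      exact absurd (hu _ (mul_mem (mul_mem hl' hi) (inv_mem hl'))) (not_le.2 h5)
    rw [← mul_assoc, D.length_mul_s hpos, h4]
    omega

omit hlam in
theorem exists_minRep (w : D.W) : ∃ u ∈ D.minReps lam, ∃ v ∈ D.stab lam, w = u * v := by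
  obtain ⟨v, hv⟩ : ∃ v : D.stab lam, ∀ v' : D.stab lam,
      D.length (w * v) ≤ D.length (w * v') :=
    ⟨Function.argmin (fun v : D.stab lam => D.length (w * v)),
      fun v' => Function.argmin_le (fun v : D.stab lam => D.length (w * v)) v'⟩
  refine ⟨w * v, fun v' hv' => ?_, (v : D.W)⁻¹, inv_mem v.2, by simp⟩
  simpa [mul_assoc] using hv ⟨v * v', mul_mem v.2 hv'⟩

theorem IsDominant.minRep_unique {u u' v v' : D.W} (hu : u ∈ D.minReps lam)
    (hu' : u' ∈ D.minReps lam) (hv : v ∈ D.stab lam) (hv' : v' ∈ D.stab lam)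
    (h : u * v = u' * v') : u = u' ∧ v = v' := by
  have e : u' = u * (v * v'⁻¹) := by rw [← mul_assoc, h, mul_inv_cancel_right]
  have hm : v * v'⁻¹ ∈ D.stab lam := mul_mem hv (inv_mem hv')
  have h1 := hlam.length_mul hu hm
  have h2 := hu' _ (inv_mem hm)
  rw [← e] at h1
  rw [e, mul_inv_cancel_right, ← e] at h2
  have h3 : v * v'⁻¹ = 1 := D.eq_one_of_length (by omega)
  rw [h3, mul_one] at e
  exact ⟨e.symm, mul_inv_eq_one.1 h3⟩

/-- For a minimal coset representative `w`, the length of `w` is at most the height of `λ - w λ`. -/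
theorem IsDominant.length_le_ht {w : D.W} (hw : w ∈ D.minReps lam) :
    (D.length w : ℝ) ≤ D.ht (lam - (w : V ≃ₗ[ℝ] V) lam) := by
  induction hn : D.length w generalizing w with
  | zero => simpa using ht_nonneg (hlam.sub_mem_cone w)
  | succ n ih =>
    obtain ⟨i, hi⟩ := D.exists_descent (w := w) (by rintro rfl; simp at hn)
    obtain ⟨m, hm⟩ := hlam.exists_root_eq (w := D.s i * w) (i := i) (by simp; omega)
    have e := D.s_mul_apply i (D.s i * w) lam
    rw [s_mul_cancel, hm] at e
    have h1 := ih (w := D.s i * w) (fun v hv => by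
      have h2 := hw v hv
      have h3 := D.length_le_s_mul i (w * v)
      rw [mul_assoc]
      omega) (by omega)
    have hm1 : m ≠ 0 := by
      rintro rfl
      simp only [Nat.cast_zero, zero_smul, sub_zero] at e
      -- then `w⁻¹ r_i w` fixes `λ` and shortens `w`
      have h2 := hw (w⁻¹ * (D.s i * w)) (by
        rw [mem_stab]
        change ((w⁻¹ : D.W) : V ≃ₗ[ℝ] V) (((D.s i * w : D.W) : V ≃ₗ[ℝ] V) lam) = lam
        rw [← e]
        exact (w : V ≃ₗ[ℝ] V).symm_apply_apply _)
      rw [mul_inv_cancel_left] at h2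
      omega
    have hm2 : (1 : ℝ) ≤ m := by exact_mod_cast Nat.one_le_iff_ne_zero.2 hm1
    rw [e]
    generalize ((D.s i * w : D.W) : V ≃ₗ[ℝ] V) (lam : V) = x at h1
    simp only [map_sub, map_smul, ht_coroot, smul_eq_mul, mul_one] at h1 ⊢
    push_cast
    linarith

end Dominant

/-! ### Supports of `H_w(e^λ)` -/

/-- The operator `H_{i_1} ⋯ H_{i_n}` attached to a word. -/
def heckeWord (l : List I) : Module.End D.ZHat (AddMonoidAlgebra D.ZHat D.Y) :=
  (l.map D.heckeGen).prod

theorem heckeWord_cons_apply (i : I) (l : List I) (f : AddMonoidAlgebra D.ZHat D.Y) :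
    D.heckeWord (i :: l) f = D.heckeGen i (D.heckeWord l f) := by
  simp [heckeWord]

theorem heckeGen_coeff (i : I) (f : AddMonoidAlgebra D.ZHat D.Y) (y : D.Y) :
    (D.heckeGen i f).coeff y =
      ∑ ν ∈ f.coeff.support, f.coeff ν * (D.heckeBasis i ν).coeff y := by
  have : D.heckeGen i f = ∑ ν ∈ f.coeff.support, f.coeff ν • D.heckeBasis i ν := rfl
  rw [this, AddMonoidAlgebra.coeff_sum, Finsupp.finsetSum_apply]
  rfl

open Classical in
theorem e_coeff (μ y : D.Y) : (D.e μ).coeff y = if μ = y then 1 else 0 := by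
  rw [e, AddMonoidAlgebra.coeff_single, Finsupp.single_apply]

open Classical in
theorem heckeBasis_coeff (i : I) (μ y : D.Y) : (D.heckeBasis i μ).coeff y =
    D.sigma i * (if D.reflY i μ = y then 1 else 0) +
    if 0 ≤ D.pairing i μ then
      -∑ k ∈ Finset.range (D.pairing i μ).toNat,
        D.bCoeff i (k + 1) * (if μ - (k + 1) • D.cor i = y then 1 else 0)
    else
      ∑ k ∈ Finset.range (-D.pairing i μ).toNat,
        D.bCoeff i k * (if μ + k • D.cor i = y then 1 else 0) := by
  rw [heckeBasis, AddMonoidAlgebra.coeff_add, Finsupp.add_apply, AddMonoidAlgebra.coeff_smul_apply,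
    e_coeff, smul_eq_mul]
  congr 1
  split_ifs
  · rw [AddMonoidAlgebra.coeff_neg, Finsupp.neg_apply, AddMonoidAlgebra.coeff_sum,
      Finsupp.finsetSum_apply]
    simp only [AddMonoidAlgebra.coeff_smul_apply, e_coeff, smul_eq_mul]
  · rw [AddMonoidAlgebra.coeff_sum, Finsupp.finsetSum_apply]
    simp only [AddMonoidAlgebra.coeff_smul_apply, e_coeff, smul_eq_mul]

/-- The support of `H_i(e^μ)` lies on the segment from `μ` to `r_i μ`; it does not contain `μ` if
`α_i(μ) > 0`. -/
theorem exists_of_heckeBasis_coeff_ne_zero {i : I} {μ y : D.Y}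
    (h : (D.heckeBasis i μ).coeff y ≠ 0) :
    (∃ j : ℕ, 1 ≤ j ∧ (j : ℤ) ≤ D.pairing i μ ∧ y = μ - j • D.cor i) ∨
    (∃ j : ℕ, (j : ℤ) ≤ -D.pairing i μ ∧ y = μ + j • D.cor i) := by
  classical
  by_cases hr : D.reflY i μ = y
  · rw [reflY] at hr
    rcases lt_or_ge 0 (D.pairing i μ) with hp | hp
    · obtain ⟨n, hn⟩ := Int.eq_ofNat_of_zero_le hp.le
      refine Or.inl ⟨n, by omega, by omega, ?_⟩
      rw [← hr, hn, natCast_zsmul]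
    · obtain ⟨n, hn⟩ := Int.eq_ofNat_of_zero_le (neg_nonneg.2 hp)
      refine Or.inr ⟨n, by omega, ?_⟩
      rw [← hr, sub_eq_add_neg, ← neg_smul, hn, natCast_zsmul]
  · rw [heckeBasis_coeff, if_neg hr, mul_zero, zero_add] at h
    split_ifs at h with hp
    · obtain ⟨k, hk, h⟩ := Finset.exists_ne_zero_of_sum_ne_zero (neg_ne_zero.1 h)
      have hk := Finset.mem_range.1 hk
      refine Or.inl ⟨k + 1, by omega, by omega, ?_⟩
      by_contra hcon
      rw [if_neg (Ne.symm hcon), mul_zero] at h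
      exact h rfl
    · obtain ⟨k, hk, h⟩ := Finset.exists_ne_zero_of_sum_ne_zero h
      have hk := Finset.mem_range.1 hk
      refine Or.inr ⟨k, by omega, ?_⟩
      by_contra hcon
      rw [if_neg (Ne.symm hcon), mul_zero] at h
      exact h rfl

variable {D} in
/-- For a minimal coset representative `p l` with `ℓ(p l) = ℓ(p) + ℓ(l)` and any `x`, the
translate by `x p` of the support of `H_l(e^λ)` lies in the cone below `λ`, at a depth
bounded below by half of `ℓ(p l) - ℓ(x)`.

In terms of alcove walks, `p l` is the endpoint of a minimal gallery, and `x p` the position of the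
folded gallery after the first `ℓ(p)` steps. Crossing a wall leaves `x` unchanged, folding along a
wall multiplies `x` by the corresponding reflection. A fold along a positive wall costs
the height of the coroot, which is at least half of the length of the reflection. A fold
along a negative wall may cost nothing, but decreases the length of `x`. -/
theorem IsDominant.support_bound {lam : D.Y} (hlam : D.IsDominant lam) (l : List I) (p x : D.W)
    (hl : D.length (p * D.wp l) = D.length p + l.length) (hm : p * D.wp l ∈ D.minReps lam)
    {μ : D.Y} (hμ : (D.heckeWord l (D.e lam)).coeff μ ≠ 0) :
    (lam : V) - ((x * p : D.W) : V ≃ₗ[ℝ] V) μ ∈ D.cone ∧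
      (D.length p : ℝ) + l.length ≤
        2 * D.ht (lam - ((x * p : D.W) : V ≃ₗ[ℝ] V) μ) + D.length x := by
  classical
  induction l generalizing p x μ with
  | nil =>
    have hμ' : lam = μ := by
      by_contra hcon
      simp [heckeWord, e_coeff, hcon] at hμ
    subst hμ'
    refine ⟨hlam.sub_mem_cone _, ?_⟩
    simp only [wp_nil, mul_one] at hm
    obtain ⟨u, hu, v, hv, huv⟩ := D.exists_minRep (lam := lam) (x * p)
    have h1 : ((x * p : D.W) : V ≃ₗ[ℝ] V) lam = (u : V ≃ₗ[ℝ] V) lam := by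
      rw [huv]; exact congrArg (u : V ≃ₗ[ℝ] V) hv
    have h2 := hlam.length_le_ht hu
    have h3 := hm _ (inv_mem hv)
    have h4 : p * v⁻¹ = x⁻¹ * u := by rw [mul_inv_eq_iff_eq_mul, mul_assoc, ← huv]; simp
    rw [h4] at h3
    have h5 := D.length_mul_le x⁻¹ u
    rw [length_inv] at h5
    have h6 : (D.length p : ℝ) ≤ D.length x + D.length u := by exact_mod_cast h3.trans h5
    rw [h1]
    have h7 : (0 : ℝ) ≤ D.length u := Nat.cast_nonneg _
    simp only [List.length_nil, Nat.cast_zero]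
    linarith
  | cons i l ih =>
    rw [heckeWord_cons_apply, heckeGen_coeff] at hμ
    obtain ⟨ν, hν, hμ⟩ := Finset.exists_ne_zero_of_sum_ne_zero hμ
    have hν := Finsupp.mem_support_iff.1 hν
    have hμ := D.exists_of_heckeBasis_coeff_ne_zero (right_ne_zero_of_mul hμ)
    rw [wp_cons, ← mul_assoc] at hl hm
    have hlen : D.length (p * D.s i) = D.length p + 1 := by
      have h1 := D.length_mul_le (p * D.s i) (D.wp l)
      have h2 := D.length_wp_le l
      have h3 := D.length_mul_le p (D.s i)
      have h4 := D.length_s_le i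
      simp only [List.length_cons] at hl
      omega
    have hl' : D.length (p * D.s i * D.wp l) = D.length (p * D.s i) + l.length := by
      simp only [List.length_cons] at hl
      omega
    have hp : D.PosRoot p i := (D.posRoot_iff p i).2 (by omega)
    -- the two continuations of the gallery: crossing the wall and folding along it
    obtain ⟨c1, c2⟩ := ih (p * D.s i) x hl' hm hν
    obtain ⟨f1, f2⟩ := ih (p * D.s i) (x * D.reflection p i) hl' hm hν
    have ef : x * D.reflection p i * (p * D.s i) = x * p := by
      simp [reflection, mul_assoc]
    have ef' : x * D.reflection p i = D.reflection (x * p) i * x := by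
      simp [reflection, mul_assoc]
    rw [ef] at f1 f2
    set b := ((x * p : D.W) : V ≃ₗ[ℝ] V) (D.coroot i) with hb
    have ec : ((x * (p * D.s i) : D.W) : V ≃ₗ[ℝ] V) ν =
        ((x * p : D.W) : V ≃ₗ[ℝ] V) ν - (D.pairing i ν : ℝ) • b := by
      rw [← mul_assoc]
      change ((x * p : D.W) : V ≃ₗ[ℝ] V) (((D.s i : D.W) : V ≃ₗ[ℝ] V) ν) = _
      rw [coe_s_apply, map_sub, map_smul, pairing_spec]
    rw [ec] at c1 c2
    have em : ∀ j : ℕ, ((x * p : D.W) : V ≃ₗ[ℝ] V) (ν - j • D.cor i : D.Y) =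
        ((x * p : D.W) : V ≃ₗ[ℝ] V) ν - (j : ℝ) • b := by
      intro j
      rw [AddSubgroup.coe_sub, AddSubgroup.coe_nsmul, map_sub, map_nsmul, hb,
        Nat.cast_smul_eq_nsmul]
      rfl
    have ep : ∀ j : ℕ, ((x * p : D.W) : V ≃ₗ[ℝ] V) (ν + j • D.cor i : D.Y) =
        ((x * p : D.W) : V ≃ₗ[ℝ] V) ν + (j : ℝ) • b := by
      intro j
      rw [AddSubgroup.coe_add, AddSubgroup.coe_nsmul, map_add, map_nsmul, hb,
        Nat.cast_smul_eq_nsmul]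
      rfl
    generalize hX : ((x * p : D.W) : V ≃ₗ[ℝ] V) (ν : V) = X at *
    rw [hlen] at c2 f2
    -- moving down from a known point by a natural multiple of a vector of the cone
    have step : ∀ (v w : V) (k : ℕ), w ∈ D.cone → (lam : V) - v ∈ D.cone → ∀ v',
        v' = v - (k : ℝ) • w →
        (lam : V) - v' ∈ D.cone ∧ D.ht (lam - v') = D.ht (lam - v) + k * D.ht w := by
      rintro v w k hw hv v' rfl
      have : (lam : V) - (v - (k : ℝ) • w) = (lam - v) + k • w := by
        rw [← Nat.cast_smul_eq_nsmul ℝ]; abel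
      rw [this]
      exact ⟨add_mem hv (nsmul_mem hw k), by simp⟩
    simp only [List.length_cons, Nat.cast_add, Nat.cast_one] at c2 f2 ⊢
    by_cases hpos : D.PosRoot (x * p) i
    · have hbm : b ∈ D.cone := hpos.coroot_mem
      have hb0 := ht_nonneg hbm
      rcases hμ with ⟨j, hj1, hj2, rfl⟩ | ⟨j, hj, rfl⟩
      · rw [em]
        obtain ⟨s1, s2⟩ := step X b j hbm f1 _ rfl
        refine ⟨s1, ?_⟩
        have h1 := D.length_mul_le (D.reflection (x * p) i) x
        rw [← ef'] at h1
        have h2 : (D.length (x * D.reflection p i) : ℝ) ≤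
            D.length (D.reflection (x * p) i) + D.length x := by exact_mod_cast h1
        have h3 := D.length_reflection_le hpos
        rw [← hb] at h3
        have h4 : D.ht b ≤ j * D.ht b := by
          have : (1 : ℝ) ≤ j := by exact_mod_cast hj1
          nlinarith
        rw [s2]
        linarith
      · rw [ep]
        obtain ⟨k, hk⟩ := Int.eq_ofNat_of_zero_le (sub_nonneg.2 hj)
        have hk' : (D.pairing i ν : ℝ) = -j - k := by
          have : D.pairing i ν = -j - k := by linarith
          rw [this]; push_cast; ring
        rw [hk'] at c1 c2
        obtain ⟨s1, s2⟩ := step _ b k hbm c1 (X + (j : ℝ) • b) (by module)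
        refine ⟨s1, ?_⟩
        rw [s2]
        have : 0 ≤ (k : ℝ) * D.ht b := by positivity
        linarith
    · have hbm : -b ∈ D.cone := D.neg_coroot_mem_of_not_posRoot hpos
      have hb0 := ht_nonneg hbm
      rcases hμ with ⟨j, hj1, hj2, rfl⟩ | ⟨j, hj, rfl⟩
      · rw [em]
        obtain ⟨k, hk⟩ := Int.eq_ofNat_of_zero_le (sub_nonneg.2 hj2)
        have hk' : (D.pairing i ν : ℝ) = j + k := by
          have : D.pairing i ν = j + k := by linarith
          rw [this]; push_cast; ring
        rw [hk'] at c1 c2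
        obtain ⟨s1, s2⟩ := step _ (-b) k hbm c1 (X - (j : ℝ) • b) (by module)
        refine ⟨s1, ?_⟩
        rw [s2]
        have : 0 ≤ (k : ℝ) * D.ht (-b) := by positivity
        linarith
      · rw [ep]
        obtain ⟨s1, s2⟩ := step X (-b) j hbm f1 (X + (j : ℝ) • b) (by module)
        refine ⟨s1, ?_⟩
        have h1 := D.length_mul_reflection_lt hp hpos
        have h2 : (D.length (x * D.reflection p i) : ℝ) ≤ D.length x := by exact_mod_cast h1.le
        have : 0 ≤ (j : ℝ) * D.ht (-b) := by positivity
        rw [s2]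
        linarith

theorem coeff_ne_zero_of_term_ne_zero {lam y : D.Y} {w : D.W} (h : D.term lam w y ≠ 0) :
    (D.heckeWord (D.reducedWord w) (D.e lam)).coeff y ≠ 0 := right_ne_zero_of_mul h

section Dominant

variable {D} {lam : D.Y} (hlam : D.IsDominant lam)

include hlam

/-- The exponents of `H_w(e^λ)`, for `w` a minimal coset representative, lie below `λ`, at a depth
that grows with the length of `w`. -/
theorem IsDominant.term_bound {w : D.W} (hw : w ∈ D.minReps lam) {y : D.Y}
    (h : D.term lam w y ≠ 0) :
    (lam : V) - y ∈ D.cone ∧ (D.length w : ℝ) ≤ 2 * D.ht ((lam : V) - y) := by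
  have := hlam.support_bound (D.reducedWord w) 1 1
    (by rw [one_mul, wp_reducedWord, length_one, zero_add, length_reducedWord])
    (by rwa [one_mul, wp_reducedWord]) (D.coeff_ne_zero_of_term_ne_zero h)
  simpa [length_reducedWord] using this

omit hlam in
theorem finite_length_le [Finite I] (N : ℕ) : {w : D.W | D.length w ≤ N}.Finite := by
  refine ((List.finite_length_le I N).image D.wp).subset fun w hw => ?_
  exact ⟨D.reducedWord w, (D.length_reducedWord w).trans_le hw, D.wp_reducedWord w⟩

/-- Only finitely many minimal coset representatives contribute to a given coefficient. -/
theorem IsDominant.finite_term_ne_zero [Finite I] (y : D.Y) :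
    {w ∈ D.minReps lam | D.term lam w y ≠ 0}.Finite := by
  obtain ⟨N, hN⟩ := exists_nat_ge (2 * D.ht ((lam : V) - y))
  refine (finite_length_le N).subset fun w hw => ?_
  exact_mod_cast (hlam.term_bound hw.1 hw.2).2.trans hN

end Dominant

/-! ### Coefficients of `σ_w H_w(e^λ)` -/

theorem mono_mul (x y : D.Expo) : D.mono x * D.mono y = D.mono (x + y) := by
  have : (AddMonoidAlgebra.single x.2 1 * AddMonoidAlgebra.single y.2 1 :
      AddMonoidAlgebra ℤ (D.E → ℤ)) = AddMonoidAlgebra.single (x.2 + y.2) 1 := by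
    rw [AddMonoidAlgebra.single_mul_single, mul_one]
  exact HahnSeries.single_mul_single.trans (congrArg (HahnSeries.single (x.1 + y.1)) this)

theorem mono_zero : D.mono 0 = 1 := rfl

theorem sigma_mul_sigmaInv (i : I) : D.sigma i * D.sigmaInv i = 1 := by
  rw [sigma, sigmaInv, mono_mul, add_neg_cancel, mono_zero]

theorem sigmaP_mul_sigmaPInv (i : I) : D.sigmaP i * D.sigmaPInv i = 1 := by
  rw [sigmaP, sigmaPInv, mono_mul, add_neg_cancel, mono_zero]

theorem sigma_mul_sigma_mem (i : I) : D.sigma i * D.sigma i ∈ D.ZSigmaP := by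
  have h1 : D.sigma i * D.sigmaP i ∈ D.ZSigmaP := Subring.subset_closure (Or.inl ⟨i, rfl⟩)
  have h2 : D.sigma i * D.sigmaPInv i ∈ D.ZSigmaP := Subring.subset_closure (Or.inr ⟨i, rfl⟩)
  have : D.sigma i * D.sigma i = (D.sigma i * D.sigmaP i) * (D.sigma i * D.sigmaPInv i) := by
    linear_combination (-(D.sigma i * D.sigma i)) * D.sigmaP_mul_sigmaPInv i
  rw [this]
  exact mul_mem h1 h2

theorem sigma_mul_bCoeff_mem (i : I) (k : ℕ) : D.sigma i * D.bCoeff i k ∈ D.ZSigmaP := by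
  rw [bCoeff]
  split_ifs
  · rw [mul_sub, sigma_mul_sigmaInv]
    exact sub_mem (D.sigma_mul_sigma_mem i) (one_mem _)
  · rw [mul_sub]
    exact sub_mem (Subring.subset_closure (Or.inl ⟨i, rfl⟩))
      (Subring.subset_closure (Or.inr ⟨i, rfl⟩))

theorem sigma_mul_heckeBasis_coeff_mem (i : I) (μ y : D.Y) :
    D.sigma i * (D.heckeBasis i μ).coeff y ∈ D.ZSigmaP := by
  classical
  have hite : ∀ p : Prop, [Decidable p] → (if p then (1 : D.ZHat) else 0) ∈ D.ZSigmaP := by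
    intro p _
    split_ifs
    · exact one_mem _
    · exact zero_mem _
  rw [heckeBasis_coeff, mul_add, ← mul_assoc]
  refine add_mem (mul_mem (D.sigma_mul_sigma_mem i) (hite _)) ?_
  split_ifs
  · rw [mul_neg, Finset.mul_sum]
    refine neg_mem (sum_mem fun k _ => ?_)
    rw [← mul_assoc]
    exact mul_mem (D.sigma_mul_bCoeff_mem i _) (hite _)
  · rw [Finset.mul_sum]
    refine sum_mem fun k _ => ?_
    rw [← mul_assoc]
    exact mul_mem (D.sigma_mul_bCoeff_mem i _) (hite _)

/-- The operators `σ_i H_i` are defined over `ℤ'_σ`. -/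
theorem sigma_mul_heckeWord_coeff_mem (lam : D.Y) (l : List I) (y : D.Y) :
    (l.map D.sigma).prod * (D.heckeWord l (D.e lam)).coeff y ∈ D.ZSigmaP := by
  classical
  induction l generalizing y with
  | nil =>
    simp only [List.map_nil, List.prod_nil, heckeWord, Module.End.one_apply, e_coeff]
    split_ifs <;> simp
  | cons i l ih =>
    rw [heckeWord_cons_apply, heckeGen_coeff, List.map_cons, List.prod_cons, Finset.mul_sum]
    refine sum_mem fun ν _ => ?_
    rw [show ∀ a b c d : D.ZHat, a * b * (c * d) = (b * c) * (a * d) from fun a b c d => by ring]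
    exact mul_mem (ih ν) (D.sigma_mul_heckeBasis_coeff_mem i ν y)

theorem term_mem (lam : D.Y) (w : D.W) (y : D.Y) : D.term lam w y ∈ D.ZSigmaP :=
  D.sigma_mul_heckeWord_coeff_mem lam (D.reducedWord w) y

/-! ### Braid relations for quadratic generators

For `σ σ' = 1`, the relation `X² = -(σ + σ') X` says that `T = X + σ` satisfies the Hecke relation
`(T - σ) (T + σ') = 0`. The braid relations between two such elements `T` and `U` are reduced to
relations between products of the `X`.
-/

section Quadratic

variable {R A : Type*} [CommRing R] [Ring A] [Algebra R A] {σ σ' τ τ' : R} {X Y : A}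

theorem braid_two (h : X * Y = Y * X) :
    (X + σ • 1) * (Y + τ • 1) = (Y + τ • 1) * (X + σ • 1) := by
  simp only [add_mul, mul_add, smul_mul_assoc, mul_smul_comm, one_mul, mul_one, h]
  module

theorem braid_three (hσ : σ * σ' = 1) (hX : X * X = -(σ + σ') • X) (hY : Y * Y = -(σ + σ') • Y)
    (h : X * Y * X - X = Y * X * Y - Y) :
    (X + σ • 1) * (Y + σ • 1) * (X + σ • 1) = (Y + σ • 1) * (X + σ • 1) * (Y + σ • 1) := by
  have e : ∀ X Y : A, X * X = -(σ + σ') • X → (X + σ • 1) * (Y + σ • 1) * (X + σ • 1) =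
      (X * Y * X - X) + (σ • (X * Y) + σ • (Y * X) + (σ * σ) • X + (σ * σ) • Y
        + (σ * σ * σ) • 1) := by
    intro X Y hX
    rw [show X * Y * X - X = X * Y * X - (σ * σ') • X by rw [hσ, one_smul]]
    simp only [add_mul, mul_add, smul_mul_assoc, mul_smul_comm, one_mul, mul_one, hX]
    module
  rw [e X Y hX, e Y X hY, h]
  abel

/-- The sum of `(X + σ) (Y + τ)` and of its inverse, which is central in the algebra generated by
`X` and `Y`. -/
def dihedralCasimir (σ σ' τ τ' : R) (X Y : A) : A :=
  X * Y + Y * X + (τ + τ') • X + (σ + σ') • Y + (σ * τ + σ' * τ') • 1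

theorem dihedralCasimir_mul (hX : X * X = -(σ + σ') • X) :
    dihedralCasimir σ σ' τ τ' X Y * X = X * Y * X - (σ * τ' + σ' * τ) • X := by
  simp only [dihedralCasimir, add_mul, mul_assoc, smul_mul_assoc, one_mul, hX, mul_smul_comm,
    smul_smul]
  module

theorem dihedralCasimir_comm :
    dihedralCasimir σ σ' τ τ' X Y = dihedralCasimir τ τ' σ σ' Y X := by
  simp only [dihedralCasimir]
  rw [mul_comm σ, mul_comm σ']
  abel

theorem dihedralCasimir_mul_mul (hX : X * X = -(σ + σ') • X) (Z : A) :
    dihedralCasimir σ σ' τ τ' X Y * (X * Z) = X * Y * X * Z - (σ * τ' + σ' * τ) • (X * Z) := by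
  rw [← mul_assoc, dihedralCasimir_mul hX, sub_mul, smul_mul_assoc]

/-- The characteristic equation of `(X + σ) (Y + τ)`. -/
theorem quadratic_mul_sq (hσ : σ * σ' = 1) (hτ : τ * τ' = 1) (hX : X * X = -(σ + σ') • X)
    (hY : Y * Y = -(τ + τ') • Y) :
    (X + σ • 1) * (Y + τ • 1) * ((X + σ • 1) * (Y + τ • 1)) =
      dihedralCasimir σ σ' τ τ' X Y * ((X + σ • 1) * (Y + τ • 1)) - 1 := by
  have h1 : (X + σ' • 1) * (X + σ • 1) = 1 := by
    refine Eq.trans ?_ (show (σ * σ') • (1 : A) = 1 by rw [hσ, one_smul])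
    simp only [add_mul, mul_add, smul_mul_assoc, mul_smul_comm, one_mul, mul_one, hX]
    module
  have h2 : (Y + τ' • 1) * (Y + τ • 1) = 1 := by
    refine Eq.trans ?_ (show (τ * τ') • (1 : A) = 1 by rw [hτ, one_smul])
    simp only [add_mul, mul_add, smul_mul_assoc, mul_smul_comm, one_mul, mul_one, hY]
    module
  have h3 : dihedralCasimir σ σ' τ τ' X Y =
      (X + σ • 1) * (Y + τ • 1) + (Y + τ' • 1) * (X + σ' • 1) := by
    simp only [dihedralCasimir, add_mul, mul_add, smul_mul_assoc, mul_smul_comm, one_mul, mul_one]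
    module
  have h4 : (Y + τ' • 1) * (X + σ' • 1) * ((X + σ • 1) * (Y + τ • 1)) = 1 := by
    rw [mul_assoc, ← mul_assoc (X + σ' • 1), h1, one_mul, h2]
  rw [h3, add_mul ((X + σ • 1) * (Y + τ • 1)), h4]
  abel

/-- The braid relation of length `4` says that `T U` and `U T` have the same square. By their
characteristic equations, it holds if `T U - U T` is killed by the Casimir element. -/
theorem braid_four (hσ : σ * σ' = 1) (hτ : τ * τ' = 1) (hX : X * X = -(σ + σ') • X)
    (hY : Y * Y = -(τ + τ') • Y)
    (h : X * Y * X * Y - (σ * τ' + σ' * τ) • (X * Y) =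
      Y * X * Y * X - (σ * τ' + σ' * τ) • (Y * X)) :
    (X + σ • 1) * (Y + τ • 1) * ((X + σ • 1) * (Y + τ • 1)) =
      (Y + τ • 1) * (X + σ • 1) * ((Y + τ • 1) * (X + σ • 1)) := by
  rw [quadratic_mul_sq hσ hτ hX hY, quadratic_mul_sq hτ hσ hY hX,
    ← dihedralCasimir_comm (X := X)]
  have h1 := dihedralCasimir_mul_mul (τ := τ) (τ' := τ') (Y := Y) hX Y
  have h2 := dihedralCasimir_mul_mul (τ := σ) (τ' := σ') (Y := X) hY X
  rw [← dihedralCasimir_comm (X := X), show τ * σ' + τ' * σ = σ * τ' + σ' * τ by ring] at h2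
  rw [h, ← h2] at h1
  simp only [add_mul X, add_mul Y, mul_add, smul_mul_assoc, mul_smul_comm, one_mul, mul_one, h1]
  module

/-- The braid relation of length `6` says that `T U` and `U T` have the same cube. By their
characteristic equations, it holds if `T U - U T` is killed by `Z² - 1`, for the Casimir element `Z`. -/
theorem braid_six (hσ : σ * σ' = 1) (hτ : τ * τ' = 1) (hX : X * X = -(σ + σ') • X)
    (hY : Y * Y = -(τ + τ') • Y) {p : R} (hp : p = σ * τ' + σ' * τ)
    (h : X * Y * X * Y * X * Y - (2 * p) • (X * Y * X * Y) + (p * p - 1) • (X * Y) =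
      Y * X * Y * X * Y * X - (2 * p) • (Y * X * Y * X) + (p * p - 1) • (Y * X)) :
    (X + σ • 1) * (Y + τ • 1) * ((X + σ • 1) * (Y + τ • 1)) * ((X + σ • 1) * (Y + τ • 1)) =
      (Y + τ • 1) * (X + σ • 1) * ((Y + τ • 1) * (X + σ • 1)) *
        ((Y + τ • 1) * (X + σ • 1)) := by
  set Z := dihedralCasimir σ σ' τ τ' X Y with hZ
  have hZX : ∀ B, Z * (X * B) = X * Y * X * B - p • (X * B) := fun B => by
    rw [hZ, dihedralCasimir_mul_mul hX, hp]
  have hZY : ∀ B, Z * (Y * B) = Y * X * Y * B - p • (Y * B) := fun B => by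
    rw [hZ, dihedralCasimir_comm, dihedralCasimir_mul_mul hY,
      show τ * σ' + τ' * σ = p by rw [hp]; ring]
  have h1 : Z * (Z * (X * Y)) - X * Y = Z * (Z * (Y * X)) - Y * X := by
    rw [hZX, hZY, mul_sub, mul_sub, mul_smul_comm, mul_smul_comm, hZX, hZY,
      mul_assoc (X * Y), mul_assoc X, hZX, mul_assoc (Y * X), mul_assoc Y, hZY]
    simp only [← mul_assoc] at h ⊢
    refine Eq.trans ?_ (h.trans ?_) <;> module
  have h2 : Z * (Z * ((X + σ • 1) * (Y + τ • 1))) - (X + σ • 1) * (Y + τ • 1) =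
      Z * (Z * ((Y + τ • 1) * (X + σ • 1))) - (Y + τ • 1) * (X + σ • 1) := by
    have e1 : (X + σ • (1 : A)) * (Y + τ • 1) = X * Y + (τ • X + σ • Y + (σ * τ) • 1) := by
      simp only [add_mul, mul_add, smul_mul_assoc, mul_smul_comm, one_mul, mul_one]
      module
    have e2 : (Y + τ • (1 : A)) * (X + σ • 1) = Y * X + (τ • X + σ • Y + (σ * τ) • 1) := by
      simp only [add_mul, mul_add, smul_mul_assoc, mul_smul_comm, one_mul, mul_one]
      module
    have e3 : ∀ P C, Z * (Z * (P + C)) - (P + C) = Z * (Z * P) - P + (Z * (Z * C) - C) := by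
      intro P C
      rw [mul_add, mul_add]
      abel
    rw [e1, e2, e3 (X * Y), e3 (Y * X), h1]
  have cube : ∀ S : A, S * S = Z * S - 1 → S * S * S = Z * (Z * S) - S - Z := by
    intro S hS
    rw [hS, sub_mul, one_mul, mul_assoc, hS, mul_sub, mul_one]
    abel
  have e1 := quadratic_mul_sq hσ hτ hX hY
  have e2 := quadratic_mul_sq hτ hσ hY hX
  rw [← dihedralCasimir_comm (X := X)] at e2
  rw [cube _ e1, cube _ e2, h2]

end Quadratic

/-! ### Rank two identities for divided differences -/

section RankTwo

variable {K : Type*} [CommRing K]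

/-- The operator `g ↦ a (g - r(g))`. -/
def dd (r : K →+* K) (a g : K) : K := a * (g - r g)

variable {s t : K →+* K} {a b : K}

theorem dd_dd (hs : ∀ x, s (s x) = x) (g : K) : dd s a (dd s a g) = (a + s a) * dd s a g := by
  simp only [dd, map_mul, map_sub, hs]
  ring

theorem dd_braid_two (hst : ∀ x, s (t x) = t (s x)) (ha : t a = a) (hb : s b = b) (g : K) :
    dd s a (dd t b g) = dd t b (dd s a g) := by
  simp only [dd, map_mul, map_sub, ha, hb, hst]
  ring

/-- The braid relation of length `3`, up to lower terms, for divided differences. -/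
theorem dd_braid_three (hs : ∀ x, s (s x) = x) (ht : ∀ x, t (t x) = x)
    (hst : ∀ x, s (t (s x)) = t (s (t x))) {β : K} (hb : s b = β) (ha : t a = β)
    (h1 : a * b + s a * β - 1 = b * β) (h2 : b * a + t b * β - 1 = a * β) (g : K) :
    dd s a (dd t b (dd s a g)) - dd s a g = dd t b (dd s a (dd t b g)) - dd t b g := by
  have hβ : s β = b := by rw [← hb, hs]
  have hβ' : t β = a := by rw [← ha, ht]
  simp only [dd, map_mul, map_sub, ha, hb, hs, ht, hβ, hβ', hst]
  linear_combination a * (g - s g) * h1 - b * (g - t g) * h2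

/-- The product of four divided differences, corrected by a multiple of a product of two of them,
is a multiple of the antisymmetrizer of a dihedral group of order `8`. -/
theorem dd_four (hs : ∀ x, s (s x) = x) (ht : ∀ x, t (t x) = x) {β γ p : K} (hb : s b = β)
    (ha : t a = γ) (hγ : s γ = γ) (hβ : t β = β) (hp : s p = p)
    (h : a * b + β * s a + γ * t b - p = β * γ) (g : K) :
    dd s a (dd t b (dd s a (dd t b g))) - p * dd s a (dd t b g) =
      a * b * β * γ * ((g - t g) - s (g - t g) + t (s (g - t g)) - s (t (s (g - t g)))) := by
  have hβ' : s β = b := by rw [← hb, hs]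
  have h' := congrArg s h
  simp only [map_mul, map_add, map_sub, hb, hs, hβ', hγ, hp] at h'
  simp only [dd, map_mul, map_sub, ha, hb, hs, ht, hβ, hβ', hγ]
  linear_combination a * b * (g - t g) * h - a * β * (s g - s (t g)) * h'

/-- The braid relation of length `4`, up to lower terms, for divided differences. -/
theorem dd_braid_four (hs : ∀ x, s (s x) = x) (ht : ∀ x, t (t x) = x)
    (hst : ∀ x, s (t (s (t x))) = t (s (t (s x)))) {β γ p : K} (hb : s b = β)
    (ha : t a = γ) (hγ : s γ = γ) (hβ : t β = β) (hp : s p = p) (hp' : t p = p)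
    (h : a * b + β * s a + γ * t b - p = β * γ) (g : K) :
    dd s a (dd t b (dd s a (dd t b g))) - p * dd s a (dd t b g) =
      dd t b (dd s a (dd t b (dd s a g))) - p * dd t b (dd s a g) := by
  rw [dd_four hs ht hb ha hγ hβ hp h,
    dd_four ht hs ha hb hβ hγ hp' (by linear_combination h)]
  simp only [map_sub, hst]
  ring

/-- The product of six divided differences, corrected by multiples of products of four and two of
them, is a multiple of the antisymmetrizer of a dihedral group of order `12`. -/
theorem dd_six (hs : ∀ x, s (s x) = x) (ht : ∀ x, t (t x) = x) {β γ δ ε p S T : K}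
    (hb : s b = β) (ha : t a = γ) (hγ : s γ = ε) (hβ : t β = δ) (hδ : s δ = δ) (hε : t ε = ε)
    (hp : s p = p) (hp' : t p = p) (hS : s S = S) (hS' : t S = S) (hT : s T = T) (hT' : t T = T)
    (hsa : s a = -S - a) (htb : t b = -T - b)
    (h1 : a * b + (-S - a) * β + γ * (-T - b) + (-S - γ) * δ + ε * (-T - δ) - 2 * p = β * ε)
    (h2 : a * b * (β * ε + (S + γ) * δ + ε * (T + δ)) + γ * (-T - b) * ε * (δ + T + β) +
      (-S - a) * β * (b * γ + (S + ε) * δ + γ * (T + δ)) + p * p - 1 = β * γ * δ * ε) (g : K) :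
    dd s a (dd t b (dd s a (dd t b (dd s a (dd t b g))))) -
        2 * p * dd s a (dd t b (dd s a (dd t b g))) + (p * p - 1) * dd s a (dd t b g) =
      a * b * β * γ * δ * ε * ((g - t g) - s (g - t g) + t (s (g - t g)) - s (t (s (g - t g))) +
        t (s (t (s (g - t g)))) - s (t (s (t (s (g - t g)))))) := by
  have hβ' : s β = b := by rw [← hb, hs]
  have hγ' : t γ = a := by rw [← ha, ht]
  have hε' : s ε = γ := by rw [← hγ, hs]
  have hδ' : t δ = β := by rw [← hβ, ht]
  have h1s := congrArg s h1
  have h1t := congrArg t h1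
  simp only [map_mul, map_add, map_sub, map_neg, map_ofNat, hb, hβ', hγ, hδ, hε', hp, hS, hT,
    hsa] at h1s
  simp only [map_mul, map_add, map_sub, map_neg, map_ofNat, ha, hβ, hγ', hδ', hε, hp', hS', hT',
    htb] at h1t
  have h3 : a * b * (a * b + (-S - a) * β + γ * (-T - b) - 2 * p) +
      γ * (-T - b) * (γ * (-T - b) + a * b + (-S - γ) * δ - 2 * p) +
      (-S - a) * β * (a * b + (-S - a) * β + γ * (-T - b) - 2 * p + ε * (-T - β)) +
      (p * p - 1) = β * γ * δ * ε := by
    linear_combination a * b * h1 + γ * (-T - b) * h1t + (-S - a) * β * h1s + h2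
  have h3s := congrArg s h3
  simp only [map_mul, map_add, map_sub, map_neg, map_ofNat, map_one, hb, hβ', hγ, hδ, hε', hp, hS,
    hT, hsa] at h3s
  simp only [dd, map_mul, map_sub, map_neg, ha, hb, hs, ht, hβ, hβ', hγ, hγ', hδ, hδ', hε, hε',
    hS, hS', hT, hT', hsa, htb]
  linear_combination a * b * (g - t g) * h3 - a * β * (s g - s (t g)) * h3s +
    a * b * γ * δ * (t (s g) - t (s (t g))) * h1 -
    a * β * ε * δ * (s (t (s g)) - s (t (s (t g)))) * h1s

/-- The braid relation of length `6`, up to lower terms, for divided differences. -/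
theorem dd_braid_six (hs : ∀ x, s (s x) = x) (ht : ∀ x, t (t x) = x)
    (hst : ∀ x, s (t (s (t (s (t x))))) = t (s (t (s (t (s x)))))) {β γ δ ε p S T : K}
    (hb : s b = β) (ha : t a = γ) (hγ : s γ = ε) (hβ : t β = δ) (hδ : s δ = δ) (hε : t ε = ε)
    (hp : s p = p) (hp' : t p = p) (hS : s S = S) (hS' : t S = S) (hT : s T = T) (hT' : t T = T)
    (hsa : s a = -S - a) (htb : t b = -T - b)
    (h1 : a * b + (-S - a) * β + γ * (-T - b) + (-S - γ) * δ + ε * (-T - δ) - 2 * p = β * ε)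
    (h2 : a * b * (β * ε + (S + γ) * δ + ε * (T + δ)) + γ * (-T - b) * ε * (δ + T + β) +
      (-S - a) * β * (b * γ + (S + ε) * δ + γ * (T + δ)) + p * p - 1 = β * γ * δ * ε)
    (h3 : b * a * (γ * δ + (T + β) * ε + δ * (S + ε)) + β * (-S - a) * δ * (ε + S + γ) +
      (-T - b) * γ * (a * β + (T + δ) * ε + β * (S + ε)) + p * p - 1 = γ * β * ε * δ) (g : K) :
    dd s a (dd t b (dd s a (dd t b (dd s a (dd t b g))))) -
        2 * p * dd s a (dd t b (dd s a (dd t b g))) + (p * p - 1) * dd s a (dd t b g) =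
      dd t b (dd s a (dd t b (dd s a (dd t b (dd s a g))))) -
        2 * p * dd t b (dd s a (dd t b (dd s a g))) + (p * p - 1) * dd t b (dd s a g) := by
  rw [dd_six hs ht hb ha hγ hβ hδ hε hp hp' hS hS' hT hT' hsa htb h1 h2,
    dd_six ht hs ha hb hβ hγ hε hδ hp' hp hT' hT hS' hS htb hsa (by linear_combination h1) h3]
  simp only [map_sub, hst]
  ring

/-- For `A = 1 / (1 - x)`, `B = 1 / (1 - y)` and `C = 1 / (1 - x y)`. -/
theorem geom_mul_geom {x y A B C : K} (hA : (1 - x) * A = 1) (hB : (1 - y) * B = 1)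
    (hC : (1 - x * y) * C = 1) : A * B = C * (A + B - 1) := by
  linear_combination (-(A * B)) * hC + C * (A * hB + B * hA - (1 - x) * A * hB - hA)

variable {σ σ' τ τ' : K}

/-- The identity behind the braid relation of length `3`. -/
theorem rankTwo_three {A B C a b β : K} (hσ : σ * σ' = 1) (h : A * B = C * (A + B - 1))
    (ha : a = -σ + (σ - σ') * A) (hb : b = -σ + (σ - σ') * B) (hβ : β = -σ + (σ - σ') * C) :
    a * b + (-(σ + σ') - a) * β - 1 = b * β := by
  subst ha hb hβ
  linear_combination (σ - σ') ^ 2 * h + hσ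

/-- The identity behind the braid relation of length `4`; the `B` are `1 / (1 - y²)` and
`1 / (1 - x² y²)`, for parameters `τ - τ'` and `υ` at even and odd powers. -/
theorem rankTwo_four {x y A G B C υ a b β γ : K} (hA : (1 - x) * A = 1)
    (hG : (1 - x * (y * y)) * G = 1) (hB : (1 - y * y) * B = 1)
    (hC : (1 - x * (x * (y * y))) * C = 1)
    (ha : a = -σ + (σ - σ') * A) (hγ : γ = -σ + (σ - σ') * G)
    (hb : b = -τ + ((τ - τ') + υ * y) * B) (hβ : β = -τ + ((τ - τ') + υ * (x * y)) * C) :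
    a * b + β * (-(σ + σ') - a) + γ * (-(τ + τ') - b) - (σ * τ' + σ' * τ) = β * γ := by
  have h1 := geom_mul_geom hA hB hG
  have h2 := geom_mul_geom hA hG hC
  have h3 : B * (A - G) = x * A * G := by
    linear_combination (-(B * A)) * hG + B * G * hA + x * A * G * hB
  subst ha hb hβ hγ
  linear_combination (σ - σ') * (τ - τ') * (h1 + h2) +
    (σ - σ') * υ * (y * h3 + x * y * h2)

/-! For the root system `G₂`, with simple coroots of exponentials `x` and `y`, the elements `A`, `G`, `E`
stand for `1 / (1 - x)`, `1 / (1 - x y³)`, `1 / (1 - x² y³)`, and `B`, `C`, `D` for `1 / (1 - y)`,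
`1 / (1 - x y)`, `1 / (1 - x y²)`. -/

section Six

variable {A G E B C D a γ ε b β δ : K} (h1 : A * B = C * (A + B - 1)) (h2 : C * B = D * (C + B - 1))
  (h3 : D * B = G * (D + B - 1)) (h4 : C * D = E * (C + D - 1)) (h5 : A * G = E * (A + G - 1))
  (ha : a = -σ + (σ - σ') * A) (hγ : γ = -σ + (σ - σ') * G) (hε : ε = -σ + (σ - σ') * E)
  (hb : b = -τ + (τ - τ') * B) (hβ : β = -τ + (τ - τ') * C) (hδ : δ = -τ + (τ - τ') * D)

include h1 h2 h3 h4 ha hγ hε hb hβ hδ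

/-- The first identity behind the braid relation of length `6`. -/
theorem rankTwo_six_quadratic :
    a * b + (-(σ + σ') - a) * β + γ * (-(τ + τ') - b) + (-(σ + σ') - γ) * δ +
      ε * (-(τ + τ') - δ) - 2 * (σ * τ' + σ' * τ) = β * ε := by
  subst ha hγ hε hb hβ hδ
  linear_combination (σ - σ') * (τ - τ') * (h1 + h2 + h3 + h4)

include h5

/-- The second identity behind the braid relation of length `6`. -/
theorem rankTwo_six_quartic (hσ : σ * σ' = 1) (hτ : τ * τ' = 1) {p : K}
    (hp : p = σ * τ' + σ' * τ) :
    a * b * (β * ε + ((σ + σ') + γ) * δ + ε * ((τ + τ') + δ)) +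
      γ * (-(τ + τ') - b) * ε * (δ + (τ + τ') + β) +
      (-(σ + σ') - a) * β * (b * γ + ((σ + σ') + ε) * δ + γ * ((τ + τ') + δ)) + p * p - 1 =
      β * γ * δ * ε := by
  -- in homogeneous form, the identity no longer needs `σ σ' = 1` and `τ τ' = 1`
  rw [show (1 : K) = σ * σ' * (τ * τ') by rw [hσ, hτ, one_mul]]
  clear hσ hτ
  subst ha hγ hε hb hβ hδ hp
  grind

/-- The identity `rankTwo_six_quartic` with the two simple roots exchanged. -/
theorem rankTwo_six_quartic' (hσ : σ * σ' = 1) (hτ : τ * τ' = 1) {p : K}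
    (hp : p = σ * τ' + σ' * τ) :
    b * a * (γ * δ + ((τ + τ') + β) * ε + δ * ((σ + σ') + ε)) +
      β * (-(σ + σ') - a) * δ * (ε + (σ + σ') + γ) +
      (-(τ + τ') - b) * γ * (a * β + ((τ + τ') + δ) * ε + β * ((σ + σ') + ε)) + p * p - 1 =
      γ * β * ε * δ := by
  -- in homogeneous form, the identity no longer needs `σ σ' = 1` and `τ τ' = 1`
  rw [show (1 : K) = σ * σ' * (τ * τ') by rw [hσ, hτ, one_mul]]
  clear hσ hτ
  subst ha hγ hε hb hβ hδ hp
  grind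

end Six

end RankTwo

/-! ### Demazure-Lusztig operators over a ring with involutions -/

section DemazureLusztig

variable {R K : Type*} [CommRing R] [CommRing K] [Algebra R K] {s t : K →+* K}
  (hs : ∀ c, s (algebraMap R K c) = algebraMap R K c)
  (ht : ∀ c, t (algebraMap R K c) = algebraMap R K c)

/-- The operator `g ↦ a (g - s(g))`, as a linear map. -/
def ddEnd (a : K) : Module.End R K where
  toFun := dd s a
  map_add' x y := by simp only [dd, map_add]; ring
  map_smul' c x := by
    simp only [dd, Algebra.smul_def, map_mul, hs, RingHom.id_apply]
    ring

theorem ddEnd_apply (a g : K) : ddEnd hs a g = dd s a g := rfl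

/-- The operator `g ↦ σ g + a (g - s(g))`. -/
def demLus (σ : R) (a : K) : Module.End R K := ddEnd hs a + σ • 1

theorem demLus_apply (σ : R) (a g : K) :
    demLus hs σ a g = a * (g - s g) + algebraMap R K σ * g := by
  rw [← Algebra.smul_def]; rfl

variable {σ σ' τ τ' : R} {a b : K}

theorem ddEnd_mul_self (hs2 : ∀ x, s (s x) = x)
    (ha : s a = -(algebraMap R K σ + algebraMap R K σ') - a) :
    ddEnd hs a * ddEnd hs a = -(σ + σ') • ddEnd hs a := by
  refine LinearMap.ext fun g => ?_
  rw [Module.End.mul_apply, LinearMap.smul_apply, ddEnd_apply, ddEnd_apply, dd_dd hs2, ha,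
    Algebra.smul_def, map_neg, map_add]
  ring

theorem demLus_braid_two (hst : ∀ x, s (t x) = t (s x)) (ha : t a = a) (hb : s b = b) :
    demLus hs σ a * demLus ht τ b = demLus ht τ b * demLus hs σ a := by
  have h : ddEnd hs a * ddEnd ht b = ddEnd ht b * ddEnd hs a :=
    LinearMap.ext fun g => dd_braid_two hst ha hb g
  unfold demLus
  exact braid_two (A := Module.End R K) (σ := σ) (τ := τ) h

variable (hs2 : ∀ x, s (s x) = x) (ht2 : ∀ x, t (t x) = x)
  (hσ : σ * σ' = 1) (hτ : τ * τ' = 1)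
  (hsa : s a = -(algebraMap R K σ + algebraMap R K σ') - a)

include hs2 ht2 hσ hsa

theorem demLus_braid_three (htb : t b = -(algebraMap R K σ + algebraMap R K σ') - b)
    (hst : ∀ x, s (t (s x)) = t (s (t x))) {β : K} (hb : s b = β) (ha : t a = β)
    (h1 : a * b + s a * β - 1 = b * β) (h2 : b * a + t b * β - 1 = a * β) :
    demLus hs σ a * demLus ht σ b * demLus hs σ a =
      demLus ht σ b * demLus hs σ a * demLus ht σ b := by
  have h : ddEnd hs a * ddEnd ht b * ddEnd hs a - ddEnd hs a =
      ddEnd ht b * ddEnd hs a * ddEnd ht b - ddEnd ht b :=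
    LinearMap.ext fun g => dd_braid_three hs2 ht2 hst hb ha h1 h2 g
  have key := @braid_three R (Module.End R K) _ _ _ σ σ' (ddEnd hs a) (ddEnd ht b) hσ
  exact key (ddEnd_mul_self hs hs2 hsa) (ddEnd_mul_self ht ht2 htb) h

variable (htb : t b = -(algebraMap R K τ + algebraMap R K τ') - b)

include hτ htb

theorem demLus_braid_four
    (hst : ∀ x, s (t (s (t x))) = t (s (t (s x)))) {β γ : K} (hb : s b = β)
    (ha : t a = γ) (hγ : s γ = γ) (hβ : t β = β)
    (h : a * b + β * s a + γ * t b - algebraMap R K (σ * τ' + σ' * τ) = β * γ) :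
    demLus hs σ a * demLus ht τ b * (demLus hs σ a * demLus ht τ b) =
      demLus ht τ b * demLus hs σ a * (demLus ht τ b * demLus hs σ a) := by
  have h : ddEnd hs a * ddEnd ht b * ddEnd hs a * ddEnd ht b -
      (σ * τ' + σ' * τ) • (ddEnd hs a * ddEnd ht b) =
      ddEnd ht b * ddEnd hs a * ddEnd ht b * ddEnd hs a -
      (σ * τ' + σ' * τ) • (ddEnd ht b * ddEnd hs a) := by
    refine LinearMap.ext fun g => ?_
    simp only [LinearMap.sub_apply, LinearMap.smul_apply, Module.End.mul_apply, ddEnd_apply]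
    rw [Algebra.smul_def, Algebra.smul_def]
    exact dd_braid_four hs2 ht2 hst hb ha hγ hβ (hs _) (ht _) h g
  have key := @braid_four R (Module.End R K) _ _ _ σ σ' τ τ' (ddEnd hs a) (ddEnd ht b) hσ hτ
  exact key (ddEnd_mul_self hs hs2 hsa) (ddEnd_mul_self ht ht2 htb) h

theorem demLus_braid_six
    (hst : ∀ x, s (t (s (t (s (t x))))) = t (s (t (s (t (s x)))))) {β γ δ ε : K} {p : R}
    (hpR : p = σ * τ' + σ' * τ) {S T : K}
    (hS : S = algebraMap R K σ + algebraMap R K σ') (hT : T = algebraMap R K τ + algebraMap R K τ')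
    (hb : s b = β) (ha : t a = γ) (hγ : s γ = ε) (hβ : t β = δ) (hδ : s δ = δ) (hε : t ε = ε)
    (h1 : a * b + (-S - a) * β + γ * (-T - b) + (-S - γ) * δ + ε * (-T - δ) -
      2 * algebraMap R K p = β * ε)
    (h2 : a * b * (β * ε + (S + γ) * δ + ε * (T + δ)) + γ * (-T - b) * ε * (δ + T + β) +
      (-S - a) * β * (b * γ + (S + ε) * δ + γ * (T + δ)) +
        algebraMap R K p * algebraMap R K p - 1 = β * γ * δ * ε)
    (h3 : b * a * (γ * δ + (T + β) * ε + δ * (S + ε)) + β * (-S - a) * δ * (ε + S + γ) +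
      (-T - b) * γ * (a * β + (T + δ) * ε + β * (S + ε)) +
        algebraMap R K p * algebraMap R K p - 1 = γ * β * ε * δ) :
    demLus hs σ a * demLus ht τ b * (demLus hs σ a * demLus ht τ b) *
        (demLus hs σ a * demLus ht τ b) =
      demLus ht τ b * demLus hs σ a * (demLus ht τ b * demLus hs σ a) *
        (demLus ht τ b * demLus hs σ a) := by
  have h : ddEnd hs a * ddEnd ht b * ddEnd hs a * ddEnd ht b * ddEnd hs a * ddEnd ht b -
      (2 * p) • (ddEnd hs a * ddEnd ht b * ddEnd hs a * ddEnd ht b) +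
        (p * p - 1) • (ddEnd hs a * ddEnd ht b) =
      ddEnd ht b * ddEnd hs a * ddEnd ht b * ddEnd hs a * ddEnd ht b * ddEnd hs a -
      (2 * p) • (ddEnd ht b * ddEnd hs a * ddEnd ht b * ddEnd hs a) +
        (p * p - 1) • (ddEnd ht b * ddEnd hs a) := by
    refine LinearMap.ext fun g => ?_
    simp only [LinearMap.sub_apply, LinearMap.add_apply, LinearMap.smul_apply,
      Module.End.mul_apply, ddEnd_apply]
    simp only [Algebra.smul_def, map_sub, map_mul, map_one, map_ofNat]
    rw [← hS] at hsa
    rw [← hT] at htb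
    refine dd_braid_six hs2 ht2 hst hb ha hγ hβ hδ hε (hs p) (ht p) ?_ ?_ ?_ ?_ hsa htb h1 h2 h3 g
    · rw [hS, map_add, hs, hs]
    · rw [hS, map_add, ht, ht]
    · rw [hT, map_add, hs, hs]
    · rw [hT, map_add, ht, ht]
  have key := @braid_six R (Module.End R K) _ _ _ σ σ' τ τ' (ddEnd hs a) (ddEnd ht b) hσ hτ
  exact key (ddEnd_mul_self hs hs2 hsa) (ddEnd_mul_self ht ht2 htb) hpR h

end DemazureLusztig

/-! ### The group algebra and its total ring of fractions -/

/-- The group algebra of `Y`. -/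
abbrev GA : Type _ := AddMonoidAlgebra D.ZHat D.Y

/-- The total ring of fractions of the group algebra. -/
def K : Type _ := FractionRing D.GA

instance : CommRing D.K := inferInstanceAs (CommRing (FractionRing D.GA))

instance : Algebra D.GA D.K := inferInstanceAs (Algebra D.GA (FractionRing D.GA))

instance : IsFractionRing D.GA D.K := inferInstanceAs (IsFractionRing D.GA (FractionRing D.GA))

instance : Algebra D.ZHat D.K := ((algebraMap D.GA D.K).comp (algebraMap D.ZHat D.GA)).toAlgebra

instance : IsScalarTower D.ZHat D.GA D.K := IsScalarTower.of_algebraMap_eq fun _ => rfl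

/-- The action of a simple reflection on `Y`, as an automorphism. -/
def reflYEquiv (i : I) : D.Y ≃+ D.Y where
  toFun := D.reflY i
  invFun := D.reflY i
  left_inv y := Subtype.ext <| by
    rw [coe_reflY, coe_reflY]; exact Module.involutive_reflection (D.root_coroot_self i) _
  right_inv y := Subtype.ext <| by
    rw [coe_reflY, coe_reflY]; exact Module.involutive_reflection (D.root_coroot_self i) _
  map_add' x y := Subtype.ext <| by
    rw [AddSubgroup.coe_add, coe_reflY, coe_reflY, coe_reflY, AddSubgroup.coe_add, map_add]

/-- The action of a simple reflection on the group algebra. -/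
def reflGA (i : I) : D.GA ≃ₐ[D.ZHat] D.GA :=
  AddMonoidAlgebra.domCongr D.ZHat D.ZHat (D.reflYEquiv i)

theorem reflGA_e (i : I) (y : D.Y) : D.reflGA i (D.e y) = D.e (D.reflY i y) :=
  AddMonoidAlgebra.domCongr_single ..

theorem reflGA_mem (i : I) :
    nonZeroDivisors D.GA ≤ (nonZeroDivisors D.GA).comap (D.reflGA i : D.GA →+* D.GA) := by
  intro x hx
  rw [Submonoid.mem_comap, mem_nonZeroDivisors_iff_right]
  intro y hy
  have h := congrArg (D.reflGA i).symm hy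
  rw [map_mul, map_zero] at h
  have h2 : (D.reflGA i).symm y * x = 0 := by
    rw [← h]; exact congrArg _ ((D.reflGA i).symm_apply_apply x).symm
  simpa using mem_nonZeroDivisors_iff_right.1 hx _ h2

/-- The action of a simple reflection on the total ring of fractions. -/
def reflK (i : I) : D.K →+* D.K :=
  IsLocalization.map D.K (D.reflGA i : D.GA →+* D.GA) (D.reflGA_mem i)

theorem reflK_algebraMap (i : I) (f : D.GA) :
    D.reflK i (algebraMap D.GA D.K f) = algebraMap D.GA D.K (D.reflGA i f) :=
  IsLocalization.map_eq (D.reflGA_mem i) f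

theorem reflK_scalar (i : I) (c : D.ZHat) :
    D.reflK i (algebraMap D.ZHat D.K c) = algebraMap D.ZHat D.K c := by
  rw [IsScalarTower.algebraMap_apply D.ZHat D.GA D.K, reflK_algebraMap, AlgEquiv.commutes]

/-- The image of `e^y` in the total ring of fractions. -/
def eK (y : D.Y) : D.K := algebraMap D.GA D.K (D.e y)

theorem eK_add (x y : D.Y) : D.eK (x + y) = D.eK x * D.eK y := by
  rw [eK, ← e_mul, map_mul]; rfl

theorem eK_zero : D.eK 0 = 1 := map_one _

theorem reflK_eK (i : I) (y : D.Y) : D.reflK i (D.eK y) = D.eK (D.reflY i y) := by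
  rw [eK, reflK_algebraMap, reflGA_e]; rfl

/-- Since `y` has infinite order, multiplication by `e^y` fixes no nonzero element, as its support would
be infinite. -/
theorem one_sub_e_mem {y : D.Y} (hy : y ≠ 0) : 1 - D.e y ∈ nonZeroDivisors D.GA := by
  rw [mem_nonZeroDivisors_iff_right]
  intro f hf
  rw [mul_sub, mul_one, sub_eq_zero] at hf
  have h1 : ∀ x, f.coeff (x + y) = f.coeff x := by
    intro x
    conv_lhs => rw [hf]
    simp [e]
  have h2 : ∀ (n : ℕ) x, f.coeff (x + n • y) = f.coeff x := by
    intro n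
    induction n with
    | zero => simp
    | succ n ih => intro x; rw [succ_nsmul, ← add_assoc, h1, ih]
  by_contra hne
  obtain ⟨x, hx⟩ : ∃ x, f.coeff x ≠ 0 := by
    by_contra! hcon
    exact hne (AddMonoidAlgebra.coeff_injective (Finsupp.ext hcon))
  have hinj : Function.Injective fun n : ℕ => x + n • y := by
    intro m n hmn
    have h3 : ((m • y : D.Y) : V) = (n • y : D.Y) := congrArg _ (add_left_cancel hmn)
    rw [AddSubgroup.coe_nsmul, AddSubgroup.coe_nsmul, ← Nat.cast_smul_eq_nsmul ℝ,
      ← Nat.cast_smul_eq_nsmul ℝ] at h3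
    exact_mod_cast smul_left_injective ℝ (fun h => hy (Subtype.ext h)) h3
  refine Set.infinite_range_of_injective hinj
    (f.coeff.support.finite_toSet.subset ?_)
  rintro _ ⟨n, rfl⟩
  simpa [h2] using hx

/-- The inverse of `1 - e^y` in the total ring of fractions (junk for `y = 0`). -/
def geom (y : D.Y) : D.K := Ring.inverse (1 - D.eK y)

theorem mul_geom {y : D.Y} (hy : y ≠ 0) : (1 - D.eK y) * D.geom y = 1 := by
  refine Ring.mul_inverse_cancel _ ?_
  have := IsLocalization.map_units D.K (⟨_, D.one_sub_e_mem hy⟩ : nonZeroDivisors D.GA)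
  simpa [eK] using this

theorem reflY_ne_zero (i : I) {y : D.Y} (hy : y ≠ 0) : D.reflY i y ≠ 0 :=
  fun h => hy ((D.reflYEquiv i).map_eq_zero_iff.1 h)

theorem eq_geom {y : D.Y} (hy : y ≠ 0) {g : D.K} (hg : (1 - D.eK y) * g = 1) : g = D.geom y := by
  linear_combination D.geom y * hg - g * D.mul_geom hy

theorem reflK_geom (i : I) {y : D.Y} (hy : y ≠ 0) :
    D.reflK i (D.geom y) = D.geom (D.reflY i y) := by
  apply D.eq_geom (D.reflY_ne_zero i hy)
  have := congrArg (D.reflK i) (D.mul_geom hy)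
  rwa [map_mul, map_sub, map_one, reflK_eK] at this

theorem geom_neg {y : D.Y} (hy : y ≠ 0) : D.geom (-y) = 1 - D.geom y := by
  refine (D.eq_geom (neg_ne_zero.2 hy) ?_).symm
  have h : D.eK (-y) * D.eK y = 1 := by rw [← eK_add, neg_add_cancel, eK_zero]
  linear_combination D.geom y * h - (-D.eK (-y)) * D.mul_geom hy

/-- The element `b(σ_i, σ'_i; e^y) - σ_i` of the total ring of fractions. -/
def dK (i : I) (y : D.Y) : D.K :=
  -algebraMap D.ZHat D.K (D.sigma i) +
    ((algebraMap D.ZHat D.K (D.sigma i) - algebraMap D.ZHat D.K (D.sigmaInv i)) +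
      algebraMap D.ZHat D.K (D.sigmaP i - D.sigmaPInv i) * D.eK y) * D.geom (y + y)

theorem add_self_ne_zero {y : D.Y} (hy : y ≠ 0) : y + y ≠ 0 := by
  intro h
  apply hy
  have : (y : V) + y = 0 := congrArg Subtype.val h
  rw [← two_smul ℝ] at this
  exact Subtype.ext ((smul_eq_zero.1 this).resolve_left two_ne_zero)

theorem reflK_dK (i j : I) {y : D.Y} (hy : y ≠ 0) :
    D.reflK i (D.dK j y) = D.dK j (D.reflY i y) := by
  have h : D.reflY i (y + y) = D.reflY i y + D.reflY i y := map_add (D.reflYEquiv i) y y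
  simp only [dK, RingHom.map_add, RingHom.map_neg, RingHom.map_mul, RingHom.map_sub, reflK_scalar,
    reflK_eK, D.reflK_geom i (D.add_self_ne_zero hy), h]

theorem dK_neg (i : I) {y : D.Y} (hy : y ≠ 0) : D.dK i (-y) =
    -(algebraMap D.ZHat D.K (D.sigma i) + algebraMap D.ZHat D.K (D.sigmaInv i)) - D.dK i y := by
  have h : D.eK (-y) * D.eK y = 1 := by rw [← eK_add, neg_add_cancel, eK_zero]
  have h2 : -y + -y = -(y + y) := by abel
  have h3 := D.mul_geom (D.add_self_ne_zero hy)
  rw [eK_add] at h3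
  rw [dK, dK, h2, D.geom_neg (D.add_self_ne_zero hy)]
  set v := algebraMap D.ZHat D.K (D.sigmaP i - D.sigmaPInv i)
  linear_combination (-v * D.eK (-y)) * h3 - (v * D.eK y * D.geom (y + y)) * h

/-- If `σ_i = σ'_i`, the factor `1 + e^y` cancels in `b(σ_i, σ'_i; e^y)`. -/
theorem dK_of_surjective {i : I} (hi : Function.Surjective (D.pairing i)) {y : D.Y} (hy : y ≠ 0) :
    D.dK i y = -algebraMap D.ZHat D.K (D.sigma i) +
      (algebraMap D.ZHat D.K (D.sigma i) - algebraMap D.ZHat D.K (D.sigmaInv i)) * D.geom y := by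
  have h1 : D.sigmaP i - D.sigmaPInv i = D.sigma i - D.sigmaInv i := by
    simp [sigma, sigmaP, sigmaInv, sigmaPInv, expSigmaP, hi]
  have h2 := D.mul_geom (D.add_self_ne_zero hy)
  rw [eK_add] at h2
  have h3 : (1 + D.eK y) * D.geom (y + y) = D.geom y :=
    D.eq_geom hy (by linear_combination h2)
  rw [dK, h1, map_sub]
  linear_combination (algebraMap D.ZHat D.K (D.sigma i) -
    algebraMap D.ZHat D.K (D.sigmaInv i)) * h3

theorem cor_ne_zero (i : I) : D.cor i ≠ 0 := fun h =>
  D.coroot_ne_zero 1 i (congrArg Subtype.val h)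

theorem reflY_cor (i j : I) : D.reflY i (D.cor j) = D.cor j - D.A i j • D.cor i := rfl

theorem reflY_cor_self (i : I) : D.reflY i (D.cor i) = -D.cor i := by
  rw [reflY_cor, A_self, two_smul]; abel

/-- The operator `H_i` on the total ring of fractions of the group algebra. -/
def opH (i : I) : Module.End D.ZHat D.K :=
  demLus (D.reflK_scalar i) (D.sigma i) (D.dK i (D.cor i))

theorem smul_eq_mul_K (c : D.ZHat) (g : D.K) : c • g = algebraMap D.ZHat D.K c * g :=
  Algebra.smul_def c g

/-- The group algebra embeds into its total ring of fractions compatibly with `H_i`. -/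
theorem algebraMap_heckeGen (i : I) (f : D.GA) : algebraMap D.GA D.K (D.heckeGen i f) =
    D.opH i (algebraMap D.GA D.K f) := by
  have hlin : ∀ (c : D.ZHat) (g : D.GA),
      algebraMap D.GA D.K (c • g) = c • algebraMap D.GA D.K g := by
    intro c g
    rw [Algebra.smul_def, Algebra.smul_def, map_mul, ← IsScalarTower.algebraMap_apply]
  have hbasis : ∀ μ, algebraMap D.GA D.K (D.heckeBasis i μ) =
      D.opH i (D.eK μ) := by
    intro μ
    have h := congrArg (algebraMap D.GA D.K) (D.heckeBasis_spec i μ)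
    simp only [RingHom.map_mul, RingHom.map_sub, RingHom.map_one, RingHom.map_add, hlin,
      smul_eq_mul_K, mul_one] at h
    have h3 := D.mul_geom (D.add_self_ne_zero (D.cor_ne_zero i))
    rw [eK_add] at h3
    rw [opH, demLus_apply, dK, reflK_eK, RingHom.map_sub]
    simp only [eK] at h h3 ⊢
    linear_combination D.geom (D.cor i + D.cor i) * h -
      (algebraMap D.GA D.K (D.heckeBasis i μ) -
        algebraMap D.ZHat D.K (D.sigma i) * algebraMap D.GA D.K (D.e (D.reflY i μ))) * h3
  have h1 : D.heckeGen i f = ∑ ν ∈ f.coeff.support, f.coeff ν • D.heckeBasis i ν := rfl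
  have h2 : f = ∑ ν ∈ f.coeff.support, f.coeff ν • D.e ν := by
    apply AddMonoidAlgebra.coeff_injective
    conv_lhs => rw [← f.coeff.sum_single]
    rw [AddMonoidAlgebra.coeff_sum]
    simp [Finsupp.sum, e]
  conv_rhs => rw [h2]
  rw [h1, map_sum, map_sum, map_sum]
  refine Finset.sum_congr rfl fun ν _ => ?_
  rw [hlin, hlin, map_smul, hbasis]
  rfl

/-- The reflections of the total ring of fractions satisfy the relations of the Weyl group. -/
theorem prod_reflK_eq {l l' : List I} (h : D.wp l = D.wp l') (x : D.K) :
    (l.map D.reflK).prod x = (l'.map D.reflK).prod x := by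
  have key : ∀ l : List I, (∀ c, (l.map D.reflK).prod (algebraMap D.ZHat D.K c) =
      algebraMap D.ZHat D.K c) ∧ ∀ y : D.Y, ∃ y' : D.Y,
      (y' : V) = (D.wp l : V ≃ₗ[ℝ] V) (y : V) ∧
      (l.map D.reflK).prod (D.eK y) = D.eK y' := by
    intro l
    induction l with
    | nil => exact ⟨fun c => rfl, fun y => ⟨y, rfl, rfl⟩⟩
    | cons i l ih =>
      refine ⟨fun c => ?_, fun y => ?_⟩
      · rw [List.map_cons, List.prod_cons, RingHom.coe_mul, Function.comp_apply, ih.1, reflK_scalar]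
      · obtain ⟨y', h1, h2⟩ := ih.2 y
        refine ⟨D.reflY i y', ?_, ?_⟩
        · rw [coe_reflY, h1]; rfl
        · rw [List.map_cons, List.prod_cons, RingHom.coe_mul, Function.comp_apply, h2, reflK_eK]
  refine RingHom.congr_fun (IsLocalization.ringHom_ext (nonZeroDivisors D.GA)
    (AddMonoidAlgebra.ringHom_ext (fun c => ?_) fun y => ?_)) x
  · have e1 : (algebraMap D.GA D.K) (AddMonoidAlgebra.single 0 c) = algebraMap D.ZHat D.K c :=
      (IsScalarTower.algebraMap_apply D.ZHat D.GA D.K c).symm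
    rw [RingHom.comp_apply, RingHom.comp_apply, e1, (key l).1, (key l').1]
  · obtain ⟨y1, h1, h2⟩ := (key l).2 y
    obtain ⟨y2, h3, h4⟩ := (key l').2 y
    rw [h, ← h3] at h1
    rw [Subtype.ext h1] at h2
    exact h2.trans h4.symm

theorem reflK_reflK (i : I) (x : D.K) : D.reflK i (D.reflK i x) = x :=
  D.prod_reflK_eq (l := [i, i]) (l' := []) (by
    rw [wp_cons, wp_cons, wp_nil, mul_one, s_mul_s]) x

/-! ### Braid relations for the Demazure-Lusztig operators -/

/-- The combination `m α_i∨ + n α_j∨` of two simple coroots. -/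
def corComb (i j : I) (m n : ℤ) : D.Y := m • D.cor i + n • D.cor j

theorem corComb_comm (i j : I) (m n : ℤ) : D.corComb i j m n = D.corComb j i n m := add_comm _ _

theorem corComb_one_zero (i j : I) : D.corComb i j 1 0 = D.cor i := by simp [corComb]

theorem corComb_zero_one (i j : I) : D.corComb i j 0 1 = D.cor j := by simp [corComb]

theorem corComb_ne_zero {i j : I} (h : i ≠ j) {m n : ℤ} (hmn : m ≠ 0 ∨ n ≠ 0) :
    D.corComb i j m n ≠ 0 := by
  intro h0
  have h1 : (m : ℝ) • D.coroot i + (n : ℝ) • D.coroot j = 0 := by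
    have := congrArg Subtype.val h0
    simpa [corComb, cor, Int.cast_smul_eq_zsmul] using this
  have hli : LinearIndependent ℝ ![D.coroot i, D.coroot j] := by
    have hinj : Function.Injective ![i, j] := by
      intro a b hab
      fin_cases a <;> fin_cases b <;> simp_all [h.symm]
    have := D.coroot_linearIndependent.comp ![i, j] hinj
    convert this using 1
    ext a
    fin_cases a <;> rfl
  have h2 := LinearIndependent.pair_iff.1 hli _ _ h1
  rcases hmn with hm | hn
  · exact hm (by exact_mod_cast h2.1)
  · exact hn (by exact_mod_cast h2.2)

theorem reflY_corComb (i j : I) (m n : ℤ) :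
    D.reflY i (D.corComb i j m n) = D.corComb i j (-m - n * D.A i j) n := by
  have h : D.reflY i (m • D.cor i + n • D.cor j) =
      m • D.reflY i (D.cor i) + n • D.reflY i (D.cor j) := by
    change D.reflYEquiv i _ = m • D.reflYEquiv i _ + n • D.reflYEquiv i _
    rw [map_add, map_zsmul, map_zsmul]
  rw [corComb, h, reflY_cor_self, reflY_cor, corComb]
  module

theorem reflK_dK_corComb {i j : I} (h : i ≠ j) (k : I) {m n : ℤ} (hmn : m ≠ 0 ∨ n ≠ 0) :
    D.reflK i (D.dK k (D.corComb i j m n)) = D.dK k (D.corComb i j (-m - n * D.A i j) n) := by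
  rw [D.reflK_dK _ _ (D.corComb_ne_zero h hmn), reflY_corComb]

theorem reflK_dK_corComb' {i j : I} (h : i ≠ j) (k : I) {m n : ℤ} (hmn : m ≠ 0 ∨ n ≠ 0) :
    D.reflK j (D.dK k (D.corComb i j m n)) = D.dK k (D.corComb i j m (-n - m * D.A j i)) := by
  rw [corComb_comm, D.reflK_dK_corComb h.symm k hmn.symm, corComb_comm]

theorem eK_corComb (i j : I) (m n : ℕ) :
    D.eK (D.corComb i j m n) = D.eK (D.cor i) ^ m * D.eK (D.cor j) ^ n := by
  have h : ∀ (k : I) (n : ℕ), D.eK (n • D.cor k) = D.eK (D.cor k) ^ n := by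
    intro k n
    induction n with
    | zero => simp [eK_zero]
    | succ n ih => rw [succ_nsmul, eK_add, ih, pow_succ]
  rw [corComb, eK_add, natCast_zsmul, natCast_zsmul, h, h]

theorem cls_eq_of_A {i j : I} (h1 : D.A i j = -1) (h2 : D.A j i = -1) :
    D.cls i = D.cls j :=
  Quot.sound ⟨by rw [root_coroot, h1]; simp, by rw [root_coroot, h2]; simp⟩

theorem reflK_dK_cor_self (i : I) : D.reflK i (D.dK i (D.cor i)) =
    -(algebraMap D.ZHat D.K (D.sigma i) + algebraMap D.ZHat D.K (D.sigmaInv i)) -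
      D.dK i (D.cor i) := by
  rw [D.reflK_dK i i (D.cor_ne_zero i), reflY_cor_self, D.dK_neg i (D.cor_ne_zero i)]

theorem sigma_mul_sigmaInv_K (i : I) :
    algebraMap D.ZHat D.K (D.sigma i) * algebraMap D.ZHat D.K (D.sigmaInv i) = 1 := by
  rw [← RingHom.map_mul, sigma_mul_sigmaInv, RingHom.map_one]

theorem reflK_braid {i j : I} (h : i ≠ j) (x : D.K) :
    ((alt i j (D.cox i j)).map D.reflK).prod x = ((alt j i (D.cox i j)).map D.reflK).prod x :=
  D.prod_reflK_eq (D.wp_braid h) x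

theorem opH_braid_two {i j : I} (h : i ≠ j) (hc : D.cox i j = 2) (h1 : D.A i j = 0)
    (h2 : D.A j i = 0) : D.opH i * D.opH j = D.opH j * D.opH i := by
  have hst := D.reflK_braid h
  simp only [hc, alt, List.map_cons, List.map_nil, List.prod_cons, List.prod_nil, mul_one,
    RingHom.mul_def, RingHom.comp_apply] at hst
  refine demLus_braid_two _ _ hst ?_ ?_
  · have := D.reflK_dK_corComb' h i (m := 1) (n := 0) (by simp)
    rwa [h2, show (-0 - 1 * 0 : ℤ) = 0 by norm_num, corComb_one_zero] at this
  · have := D.reflK_dK_corComb h j (m := 0) (n := 1) (by simp)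
    rwa [h1, show (-0 - 1 * 0 : ℤ) = 0 by norm_num, corComb_zero_one] at this

/-- `σ_i = σ'_i` if some Cartan integer `α_i(α_j∨)` is odd. -/
theorem odd_A {i j : I} (h : Odd (D.A i j)) : Function.Surjective (D.pairing i) :=
  D.surjective_of_odd i (D.cor j) h

theorem opH_braid_three {i j : I} (h : i ≠ j) (hc : D.cox i j = 3) (h1 : D.A i j = -1)
    (h2 : D.A j i = -1) :
    D.opH i * D.opH j * D.opH i = D.opH j * D.opH i * D.opH j := by
  have hcls := D.cls_eq_of_A h1 h2
  have hs : D.sigma j = D.sigma i := by rw [sigma, sigma, expSigma, expSigma, hcls]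
  have hs' : D.sigmaInv j = D.sigmaInv i := by
    rw [sigmaInv, sigmaInv, expSigma, expSigma, hcls]
  have hi := D.odd_A (i := i) (j := j) (by rw [h1]; decide)
  have hj := D.odd_A (i := j) (j := i) (by rw [h2]; decide)
  have hX := D.reflK_dK_cor_self i
  have hY := D.reflK_dK_cor_self j
  rw [hs, hs'] at hY
  have hst := D.reflK_braid h
  simp only [hc, alt, List.map_cons, List.map_nil, List.prod_cons, List.prod_nil, mul_one,
    RingHom.mul_def, RingHom.comp_apply] at hst
  have e1 := D.reflK_dK_corComb h j (m := 0) (n := 1) (by simp)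
  have e2 := D.reflK_dK_corComb' h i (m := 1) (n := 0) (by simp)
  rw [h1, show (-0 - 1 * -1 : ℤ) = 1 by norm_num, corComb_zero_one] at e1
  rw [h2, show (-0 - 1 * -1 : ℤ) = 1 by norm_num, corComb_one_zero] at e2
  have hn := D.corComb_ne_zero h (m := 1) (n := 1) (by simp)
  have hg1 := D.mul_geom (D.cor_ne_zero i)
  have hg2 := D.mul_geom (D.cor_ne_zero j)
  have hg3 := D.mul_geom hn
  have hx := D.eK_corComb i j 1 1
  rw [pow_one, pow_one, Nat.cast_one] at hx
  rw [hx] at hg3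
  have ha := D.dK_of_surjective hi (D.cor_ne_zero i)
  have hb := D.dK_of_surjective hj (D.cor_ne_zero j)
  have hβ := D.dK_of_surjective hj hn
  have hγ := D.dK_of_surjective hi hn
  rw [hs, hs'] at hb hβ
  rw [hγ, ← hβ] at e2
  have hm := geom_mul_geom hg1 hg2 hg3
  have r1 := rankTwo_three (D.sigma_mul_sigmaInv_K i) hm ha hb hβ
  have r2 := rankTwo_three (D.sigma_mul_sigmaInv_K i)
    (show _ = D.geom (D.corComb i j 1 1) * (_ + _ - 1) by
      linear_combination hm) hb ha hβ
  rw [← hX] at r1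
  rw [← hY] at r2
  rw [opH, opH, hs]
  exact demLus_braid_three _ _ (D.reflK_reflK i) (D.reflK_reflK j) (D.sigma_mul_sigmaInv i) hX hY
    hst e1 e2 r1 r2

/-- The positive coroots are `α_i∨`, `α_i∨ + 2 α_j∨`, with the parameters of `i`, and `α_j∨`, `α_i∨ + α_j∨`,
with those of `j`. -/
theorem opH_braid_four {i j : I} (h : i ≠ j) (hc : D.cox i j = 4) (h1 : D.A i j = -1)
    (h2 : D.A j i = -2) :
    D.opH i * D.opH j * (D.opH i * D.opH j) = D.opH j * D.opH i * (D.opH j * D.opH i) := by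
  have hi := D.odd_A (i := i) (j := j) (by rw [h1]; decide)
  have hst := D.reflK_braid h
  simp only [hc, alt, List.map_cons, List.map_nil, List.prod_cons, List.prod_nil, mul_one,
    RingHom.mul_def, RingHom.comp_apply] at hst
  have e1 := D.reflK_dK_corComb h j (m := 0) (n := 1) (by simp)
  have e2 := D.reflK_dK_corComb' h i (m := 1) (n := 0) (by simp)
  have e3 := D.reflK_dK_corComb h i (m := 1) (n := 2) (by simp)
  have e4 := D.reflK_dK_corComb' h j (m := 1) (n := 1) (by simp)
  norm_num only [h1] at e1 e3
  norm_num only [h2] at e2 e4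
  rw [corComb_zero_one] at e1
  rw [corComb_one_zero] at e2
  have n1 := D.corComb_ne_zero h (m := 1) (n := 2) (by simp)
  have n2 := D.corComb_ne_zero h (m := 1) (n := 1) (by simp)
  have hg1 := D.mul_geom (D.cor_ne_zero i)
  have hg2 := D.mul_geom (D.add_self_ne_zero (D.cor_ne_zero j))
  have hg3 := D.mul_geom n1
  have hg4 := D.mul_geom (D.add_self_ne_zero n2)
  have hx1 : D.eK (D.corComb i j 1 2) = D.eK (D.cor i) * (D.eK (D.cor j) * D.eK (D.cor j)) :=
    (D.eK_corComb i j 1 2).trans (by ring)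
  have hx2 : D.eK (D.corComb i j 1 1) = D.eK (D.cor i) * D.eK (D.cor j) :=
    (D.eK_corComb i j 1 1).trans (by ring)
  rw [eK_add] at hg2 hg4
  rw [hx1] at hg3
  rw [hx2, show ∀ x y : D.K, x * y * (x * y) = x * (x * (y * y)) by intros; ring] at hg4
  have ha := D.dK_of_surjective hi (D.cor_ne_zero i)
  have hγ := D.dK_of_surjective hi n1
  have hd : ∀ y, D.dK j y = -algebraMap D.ZHat D.K (D.sigma j) +
      ((algebraMap D.ZHat D.K (D.sigma j) - algebraMap D.ZHat D.K (D.sigmaInv j)) +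
        algebraMap D.ZHat D.K (D.sigmaP j - D.sigmaPInv j) * D.eK y) * D.geom (y + y) :=
    fun _ => rfl
  have hβ := hd (D.corComb i j 1 1)
  rw [hx2] at hβ
  have r := rankTwo_four hg1 hg3 hg2 hg4 ha hγ (hd _) hβ
  rw [← reflK_dK_cor_self, ← reflK_dK_cor_self, ← RingHom.map_mul, ← RingHom.map_mul,
    ← RingHom.map_add] at r
  exact demLus_braid_four _ _ (D.reflK_reflK i) (D.reflK_reflK j) (D.sigma_mul_sigmaInv i)
    (D.sigma_mul_sigmaInv j) (D.reflK_dK_cor_self i) (D.reflK_dK_cor_self j) hst e1 e2 e3 e4 r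

/-- The positive coroots are `α_i∨`, `α_i∨ + 3 α_j∨`, `2 α_i∨ + 3 α_j∨`, with the parameters of `i`, and
`α_j∨`, `α_i∨ + α_j∨`, `α_i∨ + 2 α_j∨`, with those of `j`. -/
theorem opH_braid_six {i j : I} (h : i ≠ j) (hc : D.cox i j = 6) (h1 : D.A i j = -1)
    (h2 : D.A j i = -3) :
    D.opH i * D.opH j * (D.opH i * D.opH j) * (D.opH i * D.opH j) =
      D.opH j * D.opH i * (D.opH j * D.opH i) * (D.opH j * D.opH i) := by
  have hi := D.odd_A (i := i) (j := j) (by rw [h1]; decide)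
  have hj := D.odd_A (i := j) (j := i) (by rw [h2]; decide)
  have hst := D.reflK_braid h
  simp only [hc, alt, List.map_cons, List.map_nil, List.prod_cons, List.prod_nil, mul_one,
    RingHom.mul_def, RingHom.comp_apply] at hst
  have e1 := D.reflK_dK_corComb h j (m := 0) (n := 1) (by simp)
  have e2 := D.reflK_dK_corComb' h i (m := 1) (n := 0) (by simp)
  have e3 := D.reflK_dK_corComb h i (m := 1) (n := 3) (by simp)
  have e4 := D.reflK_dK_corComb' h j (m := 1) (n := 1) (by simp)
  have e5 := D.reflK_dK_corComb h j (m := 1) (n := 2) (by simp)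
  have e6 := D.reflK_dK_corComb' h i (m := 2) (n := 3) (by simp)
  norm_num only [h1] at e1 e3 e5
  norm_num only [h2] at e2 e4 e6
  rw [corComb_zero_one] at e1
  rw [corComb_one_zero] at e2
  have key : ∀ {k : I} (m n : ℕ), Function.Surjective (D.pairing k) → (m : ℤ) ≠ 0 ∨ (n : ℤ) ≠ 0 →
      (1 - D.eK (D.cor i) ^ m * D.eK (D.cor j) ^ n) * D.geom (D.corComb i j m n) = 1 ∧
      D.dK k (D.corComb i j m n) = -algebraMap D.ZHat D.K (D.sigma k) +
        (algebraMap D.ZHat D.K (D.sigma k) - algebraMap D.ZHat D.K (D.sigmaInv k)) *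
          D.geom (D.corComb i j m n) := by
    intro k m n hk hmn
    have hn := D.corComb_ne_zero h hmn
    refine ⟨?_, D.dK_of_surjective hk hn⟩
    rw [← eK_corComb]
    exact D.mul_geom hn
  obtain ⟨gA, ha⟩ := key 1 0 hi (by simp)
  obtain ⟨gB, hb⟩ := key 0 1 hj (by simp)
  obtain ⟨gC, hβ⟩ := key 1 1 hj (by simp)
  obtain ⟨gD, hδ⟩ := key 1 2 hj (by simp)
  obtain ⟨gG, hγ⟩ := key 1 3 hi (by simp)
  obtain ⟨gE, hε⟩ := key 2 3 hi (by simp)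
  simp only [Nat.cast_one, Nat.cast_zero, Nat.cast_ofNat, corComb_one_zero, corComb_zero_one]
    at gA gB gC gD gG gE ha hb hβ hδ hγ hε
  have q1 := geom_mul_geom gA gB (C := D.geom (D.corComb i j 1 1)) (by linear_combination gC)
  have q2 := geom_mul_geom gC gB (C := D.geom (D.corComb i j 1 2)) (by linear_combination gD)
  have q3 := geom_mul_geom gD gB (C := D.geom (D.corComb i j 1 3)) (by linear_combination gG)
  have q4 := geom_mul_geom gC gD (C := D.geom (D.corComb i j 2 3)) (by linear_combination gE)
  have q5 := geom_mul_geom gA gG (C := D.geom (D.corComb i j 2 3)) (by linear_combination gE)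
  have hσ := D.sigma_mul_sigmaInv_K i
  have hτ := D.sigma_mul_sigmaInv_K j
  have hp : algebraMap D.ZHat D.K (D.sigma i * D.sigmaInv j + D.sigmaInv i * D.sigma j) =
    algebraMap D.ZHat D.K (D.sigma i) * algebraMap D.ZHat D.K (D.sigmaInv j) +
    algebraMap D.ZHat D.K (D.sigmaInv i) * algebraMap D.ZHat D.K (D.sigma j) := by
    rw [RingHom.map_add, RingHom.map_mul, RingHom.map_mul]
  have r1 := rankTwo_six_quadratic q1 q2 q3 q4 ha hγ hε hb hβ hδ
  have r2 := rankTwo_six_quartic q1 q2 q3 q4 q5 ha hγ hε hb hβ hδ hσ hτ hp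
  have r3 := rankTwo_six_quartic' q1 q2 q3 q4 q5 ha hγ hε hb hβ hδ hσ hτ hp
  rw [← hp] at r1
  exact demLus_braid_six _ _ (D.reflK_reflK i) (D.reflK_reflK j) (D.sigma_mul_sigmaInv i)
    (D.sigma_mul_sigmaInv j) (D.reflK_dK_cor_self i) (D.reflK_dK_cor_self j) hst rfl rfl rfl
    e1 e2 e3 e4 e5 e6 r1 r2 r3

theorem algebraMap_prod_heckeGen (l : List I) (f : D.GA) :
    algebraMap D.GA D.K ((l.map D.heckeGen).prod f) =
      (l.map D.opH).prod (algebraMap D.GA D.K f) := by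
  induction l with
  | nil => rfl
  | cons i l ih =>
    rw [List.map_cons, List.prod_cons, Module.End.mul_apply, algebraMap_heckeGen, ih, List.map_cons,
      List.prod_cons, Module.End.mul_apply]

theorem opH_braid {i j : I} (h : i ≠ j) :
    ((alt i j (D.cox i j)).map D.opH).prod = ((alt j i (D.cox i j)).map D.opH).prod := by
  have hc := D.cox_comm i j
  rcases D.cartan_cases h with ⟨h0, h1, h2⟩ | ⟨h0, h1, h2⟩ | ⟨h0, ⟨h1, h2⟩ | ⟨h1, h2⟩⟩ |
    ⟨h0, ⟨h1, h2⟩ | ⟨h1, h2⟩⟩ | ⟨h0, -⟩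
  · simpa [h0, alt] using D.opH_braid_two h h0 h1 h2
  · simpa [h0, alt, mul_assoc] using D.opH_braid_three h h0 h1 h2
  · simpa [h0, alt, mul_assoc] using D.opH_braid_four h h0 h1 h2
  · simpa [h0, alt, mul_assoc] using (D.opH_braid_four h.symm (hc.symm.trans h0) h2 h1).symm
  · simpa [h0, alt, mul_assoc] using D.opH_braid_six h h0 h1 h2
  · simpa [h0, alt, mul_assoc] using (D.opH_braid_six h.symm (hc.symm.trans h0) h2 h1).symm
  · rw [h0]; rfl

/-- The braid relations for the Demazure-Lusztig operators. -/
theorem heckeGen_braid {i j : I} (h : i ≠ j) :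
    ((alt i j (D.cox i j)).map D.heckeGen).prod = ((alt j i (D.cox i j)).map D.heckeGen).prod := by
  refine LinearMap.ext fun f => IsFractionRing.injective D.GA D.K ?_
  rw [algebraMap_prod_heckeGen, algebraMap_prod_heckeGen, D.opH_braid h]

/-- The braid relations for the `σ_i`. -/
theorem sigma_braid {i j : I} (h : i ≠ j) :
    ((alt i j (D.cox i j)).map D.sigma).prod = ((alt j i (D.cox i j)).map D.sigma).prod := by
  rcases D.cartan_cases h with ⟨h0, -⟩ | ⟨h0, h1, h2⟩ | ⟨h0, -⟩ | ⟨h0, -⟩ | ⟨h0, -⟩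
  · simp [h0, alt, mul_comm]
  · have hs : D.sigma j = D.sigma i := by
      rw [sigma, sigma, expSigma, expSigma, D.cls_eq_of_A h1 h2]
    simp [h0, alt, hs]
  · simp only [h0, alt, List.map_cons, List.map_nil, List.prod_cons, List.prod_nil]
    ring
  · simp only [h0, alt, List.map_cons, List.map_nil, List.prod_cons, List.prod_nil]
    ring
  · rw [h0]; rfl

/-! ### Multiplicativity of `σ_w` and `H_w` -/

theorem sigmaW_mul {u v : D.W} (h : D.length (u * v) = D.length u + D.length v) :
    D.sigmaW (u * v) = D.sigmaW u * D.sigmaW v := by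
  have hw : D.wp (D.reducedWord (u * v)) = D.wp (D.reducedWord u ++ D.reducedWord v) := by
    rw [wp_append, wp_reducedWord, wp_reducedWord, wp_reducedWord]
  rw [sigmaW, D.prod_eq_of_reduced D.sigma (fun _ _ => D.sigma_braid) _ _ hw, List.map_append,
    List.prod_append]
  · rfl
  · rw [wp_reducedWord, length_reducedWord]
  · rw [← hw, wp_reducedWord, List.length_append, length_reducedWord, length_reducedWord, h]

theorem hecke_mul {u v : D.W} (h : D.length (u * v) = D.length u + D.length v) :
    D.hecke (u * v) = D.hecke u * D.hecke v := by
  have hw : D.wp (D.reducedWord (u * v)) = D.wp (D.reducedWord u ++ D.reducedWord v) := by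
    rw [wp_append, wp_reducedWord, wp_reducedWord, wp_reducedWord]
  rw [hecke, D.prod_eq_of_reduced D.heckeGen (fun _ _ => D.heckeGen_braid) _ _ hw, List.map_append,
    List.prod_append]
  · rfl
  · rw [wp_reducedWord, length_reducedWord]
  · rw [← hw, wp_reducedWord, List.length_append, length_reducedWord, length_reducedWord, h]

theorem pairing_eq_zero {lam : D.Y} {i : I} (h : D.s i ∈ D.stab lam) : D.pairing i lam = 0 := by
  have h1 : (lam : V) - D.root i lam • D.coroot i = lam := by
    have := (D.mem_stab).1 h
    rwa [coe_s_apply] at this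
  rw [sub_eq_self, smul_eq_zero] at h1
  have h2 := h1.resolve_right (D.coroot_ne_zero 1 i)
  rw [pairing_spec] at h2
  exact_mod_cast h2

theorem heckeGen_e_of_mem_stab {lam : D.Y} {i : I} (h : D.s i ∈ D.stab lam) :
    D.heckeGen i (D.e lam) = D.sigma i • D.e lam := by
  rw [heckeGen_e, heckeBasis, reflY, D.pairing_eq_zero h]
  simp

section Dominant

variable {D} {lam : D.Y} (hlam : D.IsDominant lam)

include hlam

/-- `H_i` acts on `e^λ` by `σ_i` if `r_i` fixes `λ`, and the letters of reduced words of elements of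
the stabilizer fix `λ`. -/
theorem IsDominant.hecke_e_of_mem_stab {v : D.W} (hv : v ∈ D.stab lam) :
    D.hecke v (D.e lam) = D.sigmaW v • D.e lam := by
  have h : ∀ l : List I, (∀ i ∈ l, D.s i ∈ D.stab lam) →
      (l.map D.heckeGen).prod (D.e lam) = (l.map D.sigma).prod • D.e lam := by
    intro l hl
    induction l with
    | nil => simp
    | cons i l ih =>
      rw [List.map_cons, List.prod_cons, Module.End.mul_apply,
        ih fun j hj => hl j (List.mem_cons_of_mem _ hj), map_smul,
        D.heckeGen_e_of_mem_stab (hl i List.mem_cons_self), List.map_cons, List.prod_cons,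
        smul_smul, mul_comm]
  refine h _ (hlam.s_mem_stab ?_ ?_)
  · rwa [wp_reducedWord]
  · rw [wp_reducedWord, length_reducedWord]

/-- The factorization `σ_{uv} H_{uv}(e^λ) = σ_v² σ_u H_u(e^λ)`. -/
theorem IsDominant.term_mul {u v : D.W} (hu : u ∈ D.minReps lam) (hv : v ∈ D.stab lam) (y : D.Y) :
    D.term lam (u * v) y = D.sigmaW v ^ 2 * D.term lam u y := by
  have h := hlam.length_mul hu hv
  rw [term, term, D.sigmaW_mul h, D.hecke_mul h, Module.End.mul_apply, hlam.hecke_e_of_mem_stab hv,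
    map_smul, AddMonoidAlgebra.coeff_smul, Finsupp.smul_apply, smul_eq_mul]
  ring

end Dominant

/-! ### Exponents and the rings `ℤ'_σ` and `ℤ̂'_σ` -/

theorem coeff_mono (x : D.Expo) {a : D.S → ℤ} (h : (D.mono x).coeff a ≠ 0) : a = x.1 := by
  by_contra hne
  exact h (HahnSeries.coeff_single_of_ne hne)

theorem mono_mem {x : D.Expo} (hx : x ∈ D.expP) : D.mono x ∈ D.ZHatP := by
  intro a b h
  have ha : a = x.1 := D.coeff_mono x fun h0 => h (by rw [h0]; rfl)
  subst ha
  have hb : b = x.2 := by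
    by_contra hne
    have e : (D.mono x).coeff x.1 = (AddMonoidAlgebra.single x.2 1 : D.Lau) :=
      HahnSeries.coeff_single_same _ _
    rw [e] at h
    exact h (Finsupp.single_eq_of_ne hne)
  subst hb
  exact hx

theorem expSigmaP_nonneg_le (i : I) :
    0 ≤ (D.expSigmaP i).1 ∧ (D.expSigmaP i).1 ≤ (D.expSigma i).1 := by
  classical
  have h : (0 : D.S → ℤ) ≤ (D.expSigma i).1 := Pi.single_nonneg.2 zero_le_one
  rw [expSigmaP]
  split_ifs
  · exact ⟨h, le_rfl⟩
  · exact ⟨le_rfl, h⟩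

theorem nonneg_of_mem_expP {x : D.Expo} (hx : x ∈ D.expP) : 0 ≤ x.1 := by
  induction hx using AddSubmonoid.closure_induction with
  | mem x hx =>
    rcases hx with ⟨i, rfl⟩ | ⟨i, rfl⟩ <;> obtain ⟨h1, h2⟩ := D.expSigmaP_nonneg_le i
    · exact add_nonneg (h1.trans h2) h1
    · exact sub_nonneg.2 h2
  | zero => exact le_rfl
  | add x y _ _ hx hy => exact add_nonneg hx hy

theorem nonneg_of_coeff_ne_zero {f : D.ZHat} (hf : f ∈ D.ZHatP) {a : D.S → ℤ}
    (ha : f.coeff a ≠ 0) : 0 ≤ a := by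
  obtain ⟨b, hb⟩ : ∃ b, D.lcoeff (f.coeff a) b ≠ 0 := by
    by_contra! hcon
    exact ha (AddMonoidAlgebra.coeff_injective (Finsupp.ext hcon))
  exact D.nonneg_of_mem_expP (hf a b hb)

theorem zSigmaP_le_zHatP : D.ZSigmaP ≤ D.ZHatP := by
  refine Subring.closure_le.2 ?_
  rintro _ (⟨i, rfl⟩ | ⟨i, rfl⟩)
  · change D.mono _ * D.mono _ ∈ D.ZHatP
    rw [mono_mul]
    exact D.mono_mem (AddSubmonoid.subset_closure (Or.inl ⟨i, rfl⟩))
  · change D.mono _ * D.mono _ ∈ D.ZHatP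
    rw [mono_mul, ← sub_eq_add_neg]
    exact D.mono_mem (AddSubmonoid.subset_closure (Or.inr ⟨i, rfl⟩))

theorem zSigmaP_le_zSigma : D.ZSigmaP ≤ D.ZSigma := by
  refine Subring.closure_le.2 ?_
  rintro _ (⟨i, rfl⟩ | ⟨i, rfl⟩)
  · exact mul_mem (Subring.subset_closure (Or.inl (Or.inl (Or.inl ⟨i, rfl⟩))))
      (Subring.subset_closure (Or.inl (Or.inr ⟨i, rfl⟩)))
  · exact mul_mem (Subring.subset_closure (Or.inl (Or.inl (Or.inl ⟨i, rfl⟩))))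
      (Subring.subset_closure (Or.inr ⟨i, rfl⟩))

theorem prod_sigma (l : List I) : (l.map D.sigma).prod = D.mono (l.map D.expSigma).sum := by
  induction l with
  | nil => rfl
  | cons i l ih =>
    rw [List.map_cons, List.prod_cons, ih, sigma, mono_mul, List.map_cons, List.sum_cons]

instance [Finite I] : Finite D.S := Finite.of_surjective D.cls Quot.mk_surjective

theorem finsum_expSigma [Finite I] (l : List I) :
    ∑ᶠ s, (l.map D.expSigma).sum.1 s = l.length := by
  classical
  induction l with
  | nil => simp
  | cons i l ih =>
    rw [List.map_cons, List.sum_cons, Prod.fst_add]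
    simp only [Pi.add_apply]
    rw [finsum_add_distrib (Set.toFinite _) (Set.toFinite _), ih, expSigma,
      finsum_eq_single _ (D.cls i) fun s hs => by simp [hs]]
    simp [add_comm]

theorem sigmaW_sq (w : D.W) :
    D.sigmaW w ^ 2 = D.mono (2 • ((D.reducedWord w).map D.expSigma).sum) := by
  rw [sigmaW, prod_sigma, sq, mono_mul, two_nsmul]

theorem sigmaW_sq_mem (w : D.W) : D.sigmaW w ^ 2 ∈ D.ZHatP := by
  rw [sigmaW, sq]
  induction D.reducedWord w with
  | nil => simp
  | cons i l ih =>
    rw [List.map_cons, List.prod_cons, mul_mul_mul_comm]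
    exact mul_mem (D.zSigmaP_le_zHatP (D.sigma_mul_sigma_mem i)) ih

theorem finsum_of_sigmaW_sq_ne_zero [Finite I] {w : D.W} {a : D.S → ℤ}
    (h : (D.sigmaW w ^ 2).coeff a ≠ 0) : ∑ᶠ s, a s = 2 * D.length w := by
  rw [sigmaW_sq] at h
  rw [D.coeff_mono _ h, two_nsmul, Prod.fst_add]
  simp only [Pi.add_apply]
  rw [finsum_add_distrib (Set.toFinite _) (Set.toFinite _), finsum_expSigma, length_reducedWord,
    two_mul]

/-! ### Convergent families of Laurent series -/

section IsSum

variable {D} {ι κ : Type*} {t t' : ι → D.ZHat} {z z' : D.ZHat}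

theorem IsSum.unique (h : D.IsSum t z) (h' : D.IsSum t z') : z = z' := by
  classical
  refine HahnSeries.ext (funext fun a => ?_)
  obtain ⟨F, hF⟩ := h (∑ᶠ s, a s + 1)
  obtain ⟨F', hF'⟩ := h' (∑ᶠ s, a s + 1)
  rw [← hF (F ∪ F') Finset.subset_union_left a (by omega),
    hF' (F ∪ F') Finset.subset_union_right a (by omega)]

theorem IsSum.mem (h : D.IsSum t z) (ht : ∀ j, t j ∈ D.ZHatP) : z ∈ D.ZHatP := by
  intro a b hab
  obtain ⟨F, hF⟩ := h (∑ᶠ s, a s + 1)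
  rw [← hF F subset_rfl a (by omega)] at hab
  exact sum_mem (fun j _ => ht j) a b hab

theorem isSum_zero : D.IsSum (fun _ : ι => (0 : D.ZHat)) 0 :=
  fun _ => ⟨∅, fun F _ a _ => by simp⟩

theorem IsSum.add (h : D.IsSum t z) (h' : D.IsSum t' z') :
    D.IsSum (fun j => t j + t' j) (z + z') := by
  classical
  intro M
  obtain ⟨F, hF⟩ := h M
  obtain ⟨F', hF'⟩ := h' M
  refine ⟨F ∪ F', fun G hG a ha => ?_⟩
  rw [Finset.sum_add_distrib, HahnSeries.coeff_add, HahnSeries.coeff_add,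
    hF G (Finset.subset_union_left.trans hG) a ha, hF' G (Finset.subset_union_right.trans hG) a ha]

theorem IsSum.sum {U : Finset κ} {T : κ → ι → D.ZHat} {Z : κ → D.ZHat}
    (h : ∀ u ∈ U, D.IsSum (T u) (Z u)) :
    D.IsSum (fun j => ∑ u ∈ U, T u j) (∑ u ∈ U, Z u) := by
  classical
  induction U using Finset.induction_on with
  | empty => simpa using isSum_zero
  | insert u U hu ih =>
    simp only [Finset.sum_insert hu]
    exact (h u (Finset.mem_insert_self _ _)).add
      (ih fun u' hu' => h u' (Finset.mem_insert_of_mem hu'))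

theorem IsSum.of_injective {f : κ → ι} (hf : Function.Injective f) (h : D.IsSum (t ∘ f) z)
    (h0 : ∀ j, j ∉ Set.range f → t j = 0) : D.IsSum t z := by
  classical
  intro M
  obtain ⟨F, hF⟩ := h M
  refine ⟨F.map ⟨f, hf⟩, fun G hG a ha => ?_⟩
  rw [← hF (G.preimage f hf.injOn) (fun x hx => Finset.mem_preimage.2
    (hG (Finset.mem_map_of_mem ⟨f, hf⟩ hx))) a ha]
  congr 1
  exact (Finset.sum_preimage f G hf.injOn t fun x _ hx => h0 x hx).symm

/-- Multiplication by an element of `ℤ̂'_σ`, whose exponents are nonnegative, does not decrease the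
degree in the `σ_s`, hence is continuous. -/
theorem IsSum.mul [Finite I] (h : D.IsSum t z) {c : D.ZHat} (hc : c ∈ D.ZHatP) :
    D.IsSum (fun j => t j * c) (z * c) := by
  intro M
  obtain ⟨F, hF⟩ := h M
  refine ⟨F, fun G hG a ha => ?_⟩
  rw [← Finset.sum_mul, ← sub_eq_zero, ← HahnSeries.coeff_sub, ← sub_mul, HahnSeries.coeff_mul]
  refine Finset.sum_eq_zero fun x hx => ?_
  obtain ⟨h1, h2, rfl⟩ := Finset.mem_antidiagonal.1 hx
  have h3 := D.nonneg_of_coeff_ne_zero hc h2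
  have h4 : ∑ᶠ s, x.1 s ≤ ∑ᶠ s, (x.1 + x.2) s :=
    finsum_le_finsum' (Set.toFinite _) (Set.toFinite _) fun s => le_add_of_nonneg_right (h3 s)
  refine absurd ?_ h1
  rw [HahnSeries.coeff_sub, hF G hG x.1 (h4.trans_lt ha), sub_self]

/-- A family in `ℤ̂'_σ` is summable if only finitely many members have terms of degree less than `M`, for
each `M`. -/
theorem exists_isSum [Finite I] (hfin : ∀ M : ℤ,
    {j | ∃ a, ∑ᶠ s, a s < M ∧ (t j).coeff a ≠ 0}.Finite) (ht : ∀ j, t j ∈ D.ZHatP) :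
    ∃ z, D.IsSum t z := by
  have hpwo : {a : D.S → ℤ | 0 ≤ a}.IsPWO := by
    -- Dickson's lemma
    have := Set.IsPWO.pi (s := fun _ : D.S => Set.Ici (0 : ℤ)) fun _ => bddBelow_Ici.isWF.isPWO
    exact this.mono fun a ha s _ => ha s
  refine ⟨⟨fun a => ∑ᶠ j, (t j).coeff a, hpwo.mono fun a ha => ?_⟩, fun M => ?_⟩
  · obtain ⟨j, hj⟩ : ∃ j, (t j).coeff a ≠ 0 := by
      by_contra! hcon
      exact ha ((finsum_congr hcon).trans finsum_zero)
    exact D.nonneg_of_coeff_ne_zero (ht j) hj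
  · refine ⟨(hfin M).toFinset, fun F hF a ha => ?_⟩
    rw [HahnSeries.coeff_sum]
    refine (finsum_eq_sum_of_support_subset _ fun j hj => hF ?_).symm
    exact (hfin M).mem_toFinset.2 ⟨a, ha, hj⟩

end IsSum

theorem exists_isPoincare [Finite I] (G : Subgroup D.W) : ∃ z, D.IsPoincare G z := by
  refine exists_isSum (fun M => ?_) fun v => D.sigmaW_sq_mem v
  refine ((finite_length_le (D := D) M.toNat).preimage Subtype.val_injective.injOn).subset ?_
  rintro v ⟨a, ha, hv⟩
  rw [D.finsum_of_sigmaW_sq_ne_zero hv] at ha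
  change D.length v ≤ M.toNat
  omega

/-- The series over the Weyl group is the finite sum, over the relevant minimal coset representatives,
of the series over their cosets. -/
theorem IsDominant.isPSigma {D : KMApartment V I} [Finite I] {lam : D.Y}
    (hlam : D.IsDominant lam) {z : D.ZHat} (hz : D.IsPoincare (D.stab lam) z) :
    D.IsPSigma lam fun y => z * ∑ᶠ w ∈ D.minReps lam, D.term lam w y := by
  classical
  intro y
  have hfin := hlam.finite_term_ne_zero y
  have hsum : ∑ᶠ w ∈ D.minReps lam, D.term lam w y = ∑ u ∈ hfin.toFinset, D.term lam u y := by
    refine finsum_mem_eq_sum_of_inter_support_eq _ ?_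
    ext w
    simp
  have hT : ∀ u ∈ hfin.toFinset, D.IsSum
      (fun w => if u⁻¹ * w ∈ D.stab lam then D.term lam w y else 0) (z * D.term lam u y) := by
    intro u hu
    have hu' := (hfin.mem_toFinset.1 hu).1
    refine IsSum.of_injective (f := fun v : D.stab lam => u * v)
      (fun v v' h => Subtype.ext (mul_left_cancel h)) ?_ fun w hw => if_neg fun h => hw ?_
    · convert hz.mul (D.zSigmaP_le_zHatP (D.term_mem lam u y)) using 2 with v
      simp [hlam.term_mul hu' v.2]
    · exact ⟨⟨_, h⟩, mul_inv_cancel_left u w⟩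
  convert IsSum.sum hT using 1
  · funext w
    obtain ⟨u, hu, v, hv, rfl⟩ := exists_minRep (lam := lam) w
    by_cases h0 : D.term lam u y = 0
    · have h1 : D.term lam (u * v) y = 0 := by rw [hlam.term_mul hu hv, h0, mul_zero]
      simp [h1]
    · rw [Finset.sum_eq_single u, if_pos (by rwa [inv_mul_cancel_left])]
      · intro u' hu' hne
        refine if_neg fun h => hne ?_
        exact (hlam.minRep_unique (hfin.mem_toFinset.1 hu').1 hu h hv
          (mul_inv_cancel_left u' _)).1
      · exact fun h => absurd (hfin.mem_toFinset.2 ⟨hu, h0⟩) h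
  · exact (congrArg (z * ·) hsum).trans (Finset.mul_sum ..)

end

end KMApartment

theorem proposition6p4 {V I : Type*} [AddCommGroup V] [Module ℝ V] [FiniteDimensional ℝ V]
    [TopologicalSpace V] [IsTopologicalAddGroup V] [ContinuousSMul ℝ V] [T2Space V] [Finite I]
    (D : KMApartment V I) (lam : D.Y) (hlam : D.IsDominant lam) :
    ∃ (P Pmin : D.Y → D.ZHat) (z : D.ZHat),
      D.IsPSigma lam P ∧ (∀ f, D.IsPSigma lam f → f = P) ∧
      P ∈ D.formalSums ⊤ ∧ P ∈ D.formalSums D.ZHatP ∧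
      D.IsPSigmaMin lam Pmin ∧
      Pmin ∈ D.formalSums D.ZSigma ∧ Pmin ∈ D.formalSums D.ZSigmaP ∧
      D.IsPoincare (D.stab lam) z ∧ (∀ z', D.IsPoincare (D.stab lam) z' → z' = z) ∧
      z ∈ D.ZHatP ∧
      P = fun y => z * Pmin y := by
  obtain ⟨z, hz⟩ := D.exists_isPoincare (D.stab lam)
  have hzmem : z ∈ D.ZHatP := hz.mem fun v => D.sigmaW_sq_mem v
  have hP := hlam.isPSigma hz
  set Pmin : D.Y → D.ZHat := fun y => ∑ᶠ w ∈ D.minReps lam, D.term lam w y with hPmin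
  have hmem : ∀ y, Pmin y ∈ D.ZSigmaP := fun y =>
    finsum_mem_induction (· ∈ D.ZSigmaP) (zero_mem _) (fun _ _ => add_mem)
      fun w _ => D.term_mem lam w y
  have hsupp : ∀ y, Pmin y ≠ 0 → ∃ μ ∈ ({lam} : Finset D.Y), μ - y ∈ D.Qpos := by
    intro y hy
    obtain ⟨w, hw, hne⟩ := exists_ne_zero_of_finsum_mem_ne_zero hy
    exact ⟨lam, Finset.mem_singleton_self _,
      (KMApartment.mem_Qpos_iff).2 (hlam.term_bound hw hne).1⟩
  have hsupp' : ∀ y, z * Pmin y ≠ 0 → ∃ μ ∈ ({lam} : Finset D.Y), μ - y ∈ D.Qpos :=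
    fun y hy => hsupp y (right_ne_zero_of_mul hy)
  exact ⟨_, Pmin, z, hP, fun f hf => funext fun y => (hf y).unique (hP y),
    ⟨fun _ => trivial, _, hsupp'⟩,
    ⟨fun y => mul_mem hzmem (D.zSigmaP_le_zHatP (hmem y)), _, hsupp'⟩,
    fun y => ⟨hlam.finite_term_ne_zero y, rfl⟩,
    ⟨fun y => D.zSigmaP_le_zSigma (hmem y), _, hsupp⟩, ⟨hmem, _, hsupp⟩,
    hz, fun z' hz' => hz'.unique hz, hzmem, rfl⟩
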